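/- Let $e_d(\vec x)$ be the elementary symmetric functions in $\vec x=(x_1,x_2,\dots)$, with $e_0=1$ and $e_d=0$ for $d<0$. For a skew shape $\lambda/\mu$ let $$\mathrm{JT}_{\lambda/\mu}(\vec x)=\bigl(e_{\lambda_i-\mu_j-i+j}(\vec x)\bigr)_{i,j=1}^{\ell(\lambda)},$$ and let $s_\nu(\vec x)=\det \mathrm{JT}_{\nu'}(\vec x)=\det\bigl(e_{\nu'_i-i+j}(\vec x)\bigr)_{i,j=1}^{\ell(\nu')}$ be the Schur function of a partition $\nu$, where $\nu'$ is the conjugate partition. Let $*$ denote the Hadamard (entrywise) product of matrices. For a partition $\nu\vdash m$ and $I\subseteq[m-1]=\{1,\dots,m-1\}$ let $f^\nu(I)$ be the number of standard Young tableaux of shape $\nu$ with descent set $I$, where $i$ is a descent of a tableau if $i+1$ lies in a row strictly below that of $i$. A ribbon is a connected skew shape containing no $2\times2$ block of cells. Label the cells of a ribbon $R$ of size $m$ by $1,\dots,m$ sequentially, starting from the top-right cell; then $\mathrm{Des}(R)$ is the set of $i\in[m-1]$ such that the cell labeled $i$ is immediately above the cell labeled $i+1$. For $R=\lambda/\mu$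 let $R'=\lambda'/\mu'$ be the conjugate ribbon. Theorem. Let $R$ be a ribbon of size $m$. Then $$\det\bigl(\mathrm{JT}_R(\vec x)*\mathrm{JT}_R(\vec y)\bigr)=\sum_{\lambda,\mu\vdash m}\ \sum_{\substack{I,J\subseteq[m-1]\\ I\cap J=\mathrm{Des}(R')}} f^\lambda(I)\,f^\mu(J)\,s_\lambda(\vec x)\,s_\mu(\vec y).$$ More generally, for every $k\ge1$ and sequences of variables $\vec x^{(1)},\dots,\vec x^{(k)}$, $$\det\bigl(\mathrm{JT}_R(\vec x^{(1)})*\cdots*\mathrm{JT}_R(\vec x^{(k)})\bigr)=\sum_{\nu_1,\dots,\nu_k\vdash m}\Biggl(\ \sum_{\substack{A_1,\dots,A_k\subseteq[m-1]\\ A_1\cap\cdots\cap A_k=\mathrm{Des}(R')}} f^{\nu_1}(A_1)\cdots f^{\nu_k}(A_k)\Biggr)s_{\nu_1}(\vec x^{(1)})\cdots s_{\nu_k}(\vec x^{(k)}).$$ -/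

import Mathlib

open Finset

noncomputable section

/-! ### Partitions, skew shapes, ribbons

Cells are indexed from `(0, 0)` (row, column), as in Mathlib's `YoungDiagram`; the row lengths
`λ_1, λ_2, …` are `μ.rowLen 0, μ.rowLen 1, …` and the length of a partition is `μ.colLen 0`. -/

/-- A skew shape `outer / inner`. -/
structure SkewShape where
  outer : YoungDiagram
  inner : YoungDiagram
  inner_le : inner ≤ outer

namespace SkewShape

/-- The cells of a skew shape. -/
def cells (R : SkewShape) : Finset (ℕ × ℕ) := R.outer.cells \ R.inner.cells

/-- The number of cells. -/
def size (R : SkewShape) : ℕ := #R.cells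

/-- The length of `λ/μ` is the number of parts of `λ`. -/
def length (R : SkewShape) : ℕ := R.outer.colLen 0

/-- The conjugate `λ'/μ'`. -/
def conj (R : SkewShape) : SkewShape :=
  ⟨R.outer.transpose, R.inner.transpose, YoungDiagram.transpose_mono R.inner_le⟩

/-- The partition `ν` as the skew shape `ν/∅`. -/
def straight (ν : YoungDiagram) : SkewShape := ⟨ν, ⊥, bot_le⟩

/-- A ribbon is a connected skew shape without a `2 × 2` block of cells. Two cells are adjacent if
they share an edge, that is, if one covers the other in the product order of `ℕ × ℕ`.
The empty shape is allowed. -/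
def IsRibbon (R : SkewShape) : Prop :=
  ((SimpleGraph.hasse (ℕ × ℕ)).induce (R.cells : Set (ℕ × ℕ))).Preconnected ∧
  ∀ i j : ℕ, ¬ ((i, j) ∈ R.cells ∧ (i, j + 1) ∈ R.cells ∧
    (i + 1, j) ∈ R.cells ∧ (i + 1, j + 1) ∈ R.cells)

/-- The label of a cell `c` of a ribbon, when the cells are labeled `1, …, m` sequentially
starting from the top-right cell: the number of cells weakly above and weakly to the right
of `c` (including `c`), which are exactly the cells of the ribbon up to and including `c`. -/
def label (R : SkewShape) (c : ℕ × ℕ) : ℕ := #{d ∈ R.cells | d.1 ≤ c.1 ∧ c.2 ≤ d.2}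

open Classical in
/-- The descent set of a ribbon of size `m`: the `i ∈ [m-1]` such that the cell labeled `i` is
immediately above the cell labeled `i + 1`. -/
def Des (R : SkewShape) : Finset ℕ :=
  {i ∈ Icc 1 (R.size - 1) | ∃ r c : ℕ, (r, c) ∈ R.cells ∧ (r + 1, c) ∈ R.cells ∧
    R.label (r, c) = i ∧ R.label (r + 1, c) = i + 1}

end SkewShape

/-- There are finitely many partitions of `m`. -/
theorem YoungDiagram.finite_setOf_card_eq (m : ℕ) : {ν : YoungDiagram | ν.card = m}.Finite := by
  have hinj : Function.Injective (fun ν : YoungDiagram => ν.cells) := fun a b h =>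
    YoungDiagram.ext h
  refine Set.Finite.of_finite_image (f := fun ν : YoungDiagram => ν.cells) ?_ hinj.injOn
  refine ((range m ×ˢ range m).powerset.finite_toSet).subset ?_
  rintro _ ⟨ν, hν, rfl⟩
  rw [Set.mem_ofPred_eq] at hν
  simp only [coe_powerset, Set.mem_preimage, Set.mem_powerset_iff, coe_subset]
  rintro ⟨i, j⟩ hc
  have hc' : (i, j) ∈ ν := hc
  have h1 : #(ν.row i) ≤ ν.card := card_le_card (filter_subset _ _)
  have h2 : #(ν.col j) ≤ ν.card := card_le_card (filter_subset _ _)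
  rw [← ν.rowLen_eq_card] at h1
  rw [← ν.colLen_eq_card] at h2
  have h3 := YoungDiagram.mem_iff_lt_rowLen.1 hc'
  have h4 := YoungDiagram.mem_iff_lt_colLen.1 hc'
  simp only [mem_product, mem_range]
  omega

/-- The partitions `ν ⊢ m`. -/
def partitionsOf (m : ℕ) : Finset YoungDiagram := (YoungDiagram.finite_setOf_card_eq m).toFinset

/-! ### Standard Young tableaux and descents -/

namespace SemistandardYoungTableau

/-- A tableau of shape `ν` is standard if each of `1, …, |ν|` appears in it exactly once. -/
def IsStandard {ν : YoungDiagram} (T : SemistandardYoungTableau ν) : Prop :=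
  Set.BijOn (fun c : ℕ × ℕ => T c.1 c.2) ν.cells (Set.Icc 1 ν.card)

/-- The descent set of a standard tableau: the `i` such that `i + 1` appears in a row strictly
below that of `i`. -/
def descentSet {ν : YoungDiagram} (T : SemistandardYoungTableau ν) : Set ℕ :=
  {i | ∃ c ∈ ν, ∃ d ∈ ν, T c.1 c.2 = i ∧ T d.1 d.2 = i + 1 ∧ c.1 < d.1}

/-- A shape has finitely many standard tableaux. -/
theorem finite_setOf_isStandard (ν : YoungDiagram) :
    {T : SemistandardYoungTableau ν | T.IsStandard}.Finite := by
  let F : SemistandardYoungTableau ν → (ν.cells → ℕ) := fun T c => T c.1.1 c.1.2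
  have hF : Function.Injective F := by
    intro T S h
    ext i j
    by_cases hc : (i, j) ∈ ν
    · exact congrFun h ⟨(i, j), hc⟩
    · rw [T.zeros hc, S.zeros hc]
  refine Set.Finite.of_finite_image (f := F) ?_ hF.injOn
  refine (Set.Finite.pi' (fun _ : ν.cells => Set.finite_Icc 1 ν.card)).subset ?_
  rintro _ ⟨T, hT, rfl⟩ c
  exact hT.mapsTo c.2

end SemistandardYoungTableau

/-- `f^ν(I)`: the number of standard Young tableaux of shape `ν` with descent set `I`. -/
def numSYT (ν : YoungDiagram) (I : Finset ℕ) : ℕ :=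
  {T : SemistandardYoungTableau ν | T.IsStandard ∧ T.descentSet = (I : Set ℕ)}.ncard

/-! ### Symmetric functions

Symmetric functions are formal power series over `ℚ` in infinitely many variables; functions of
`k` such sequences of variables live in the power series ring on `Fin k × ℕ`, the variable
`(p, i)` being the `i`-th one of the `p`-th sequence. -/

open Classical in
/-- The elementary symmetric function `e_d` for `d : ℤ`: the sum of all squarefree monomials of
degree `d`. It is `1` for `d = 0` and `0` for `d < 0`. -/
def elemSymm (d : ℤ) : MvPowerSeries ℕ ℚ :=
  fun a : ℕ →₀ ℕ => if (∀ i, a i ≤ 1) ∧ (a.degree : ℤ) = d then 1 else 0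

/-- The dual Jacobi--Trudi matrix `(e_{λ_i - μ_j - i + j})` of size `ℓ(λ)`. -/
def SkewShape.jacobiTrudi (R : SkewShape) :
    Matrix (Fin R.length) (Fin R.length) (MvPowerSeries ℕ ℚ) :=
  Matrix.of fun i j =>
    elemSymm ((R.outer.rowLen i : ℤ) - (R.inner.rowLen j : ℤ) - (i : ℤ) + (j : ℤ))

/-- The Schur function `s_ν = det (e_{ν'_i - i + j})`, with `i, j` running up to `ℓ(ν')`. -/
def schur (ν : YoungDiagram) : MvPowerSeries ℕ ℚ := (SkewShape.straight ν).conj.jacobiTrudi.det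

instance tendstoCofinite_prodMk {k : ℕ} (p : Fin k) :
    Filter.TendstoCofinite (fun i : ℕ => (p, i)) :=
  Filter.tendstoCofinite_of_injective (Prod.mk_right_injective p)

/-- The substitution `f ↦ f(x^{(p)})` of the `p`-th sequence of variables. -/
def inVars {k : ℕ} (p : Fin k) : MvPowerSeries ℕ ℚ →ₐ[ℚ] MvPowerSeries (Fin k × ℕ) ℚ :=
  MvPowerSeries.rename (fun i : ℕ => (p, i))

/-- The Jacobi--Trudi matrix in the `p`-th sequence of variables. -/
def SkewShape.jacobiTrudiIn (R : SkewShape) {k : ℕ} (p : Fin k) :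
    Matrix (Fin R.length) (Fin R.length) (MvPowerSeries (Fin k × ℕ) ℚ) :=
  R.jacobiTrudi.map (inVars p)

/-- The Hadamard (entrywise) product of a finite family of matrices. -/
def hadamardProd {k n : ℕ} {A : Type*} [CommRing A] (M : Fin k → Matrix (Fin n) (Fin n) A) :
    Matrix (Fin n) (Fin n) A :=
  Matrix.of fun i j => ∏ p, M p i j

end

noncomputable section

/-! ### Determinants of Jacobi--Trudi type and the Pieri rule -/

/-! Let `g d` be the product over `p` of `e_d(x^(p))`; like `e_d`, it is `1` at `d = 0` and vanishes
for `d < 0`. Once empty rows are removed, the Hadamard product attached to a ribbon is the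
Hessenberg matrix `g (w_i - w_{j+1})`, where `m = w_0 > w_1 > … > 0` are the labels at which rows
end and the interior `w_i` form the complement `C` of `Des R'` in `[m-1]`. Expansion along the first
column gives a sum over `T ⊆ C`, with sign `(-1)^(#C + #T)`, of the products of `g` over the gaps of
`T ∪ {0, m}`.

For one sequence of variables, such a product of `e`'s is the sum of `s_ν` over standard tableaux
whose descent set contains `[m-1] \ T`: by the Pieri rule each factor adds a vertical strip, and
filling a strip from top to bottom creates a run of consecutive descents
(`schurDescentSum_union_Ioo`). The Pieri rule itself comes from evaluating one determinant of power
series by column and by row operations.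

Multiplying over `p`, a tuple `(A_p)` receives the total sign of all `T` with `U ⊆ T ⊆ C`, where `U`
is the complement of the intersection of the `A_p`. This is `1` if `U = C`, that is, if the
intersection is `Des R'`, and `0` otherwise. -/

theorem Matrix.det_eq_of_last_row {A : Type*} [CommRing A] {N : ℕ}
    (M : Matrix (Fin (N + 1)) (Fin (N + 1)) A) (h : ∀ j : Fin N, M (Fin.last N) j.castSucc = 0) :
    M.det = M (Fin.last N) (Fin.last N) * (M.submatrix Fin.castSucc Fin.castSucc).det := by
  rw [Matrix.det_succ_row _ (Fin.last N), Fin.sum_univ_castSucc]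
  simp [h, Fin.succAbove_last, ← two_mul]

theorem Matrix.det_eq_of_first_column {A : Type*} [CommRing A] {N : ℕ}
    (M : Matrix (Fin (N + 1)) (Fin (N + 1)) A) (h : ∀ i : Fin N, M i.succ 0 = 0) :
    M.det = M 0 0 * (M.submatrix Fin.succ Fin.succ).det := by
  rw [Matrix.det_succ_column_zero, Fin.sum_univ_succ]
  simp [h]

section JacobiTrudi

variable {A : Type*} [CommRing A] (h : ℤ → A)

/-- The determinant `det (h (c_i - i + j))` of size `N`. -/
def jtDet (c : ℕ → ℕ) (N : ℕ) : A :=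
  (Matrix.of fun i j : Fin N => h ((c i : ℤ) - (i : ℤ) + (j : ℤ))).det

/-- The power series `∑ₖ h (d + k) Xᵏ`. -/
def tailSeries (d : ℤ) : PowerSeries A := PowerSeries.mk fun k => h (d + k)

variable {h}

theorem jtDet_succ (h0 : h 0 = 1) (hneg : ∀ d < 0, h d = 0) {c : ℕ → ℕ} {N : ℕ} (hc : c N = 0) :
    jtDet h c (N + 1) = jtDet h c N := by
  rw [jtDet, Matrix.det_eq_of_last_row]
  · simp only [Matrix.of_apply, Fin.val_last, hc]
    rw [show ((0 : ℕ) : ℤ) - N + N = 0 by simp, h0, one_mul]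
    rfl
  · intro j
    apply hneg
    have := j.2
    simp [hc]

theorem jtDet_eq_of_le (h0 : h 0 = 1) (hneg : ∀ d < 0, h d = 0) {c : ℕ → ℕ} {n N : ℕ}
    (hc : ∀ i, n ≤ i → c i = 0) (hN : n ≤ N) : jtDet h c N = jtDet h c n := by
  induction N, hN using Nat.le_induction with
  | base => rfl
  | succ k hk ih => rw [jtDet_succ h0 hneg (hc k hk), ih]

theorem tailSeries_eq_add (d : ℤ) :
    tailSeries h d = PowerSeries.C (h d) + PowerSeries.X * tailSeries h (d + 1) := by
  ext k
  rcases k with _ | k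
  · simp [tailSeries]
  · simp [tailSeries, PowerSeries.coeff_succ_X_mul]
    congr 1
    ring

/-- Subtracting `X` times the next column turns every column but the last into constants. As `c N =
0`, the last row then vanishes except for its final entry, the series starting at `h 0`. -/
theorem det_tailSeries_eq_mul (hneg : ∀ d < 0, h d = 0) {c : ℕ → ℕ} {N : ℕ} (hc : c N = 0) :
    (Matrix.of fun i j : Fin (N + 1) => tailSeries h ((c i : ℤ) - (i : ℤ) + (j : ℤ))).det =
      PowerSeries.C (jtDet h c N) * tailSeries h 0 := by
  let B : Matrix (Fin (N + 1)) (Fin (N + 1)) (PowerSeries A) := Matrix.of fun i j =>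
    if j = Fin.last N then tailSeries h ((c i : ℤ) - (i : ℤ) + (j : ℤ))
    else PowerSeries.C (h ((c i : ℤ) - (i : ℤ) + (j : ℤ)))
  have hB : (Matrix.of fun i j : Fin (N + 1) =>
      tailSeries h ((c i : ℤ) - (i : ℤ) + (j : ℤ))).det = B.det := by
    -- Columns are reversed because each is reduced by its right neighbour, while the determinant
    -- lemma uses the preceding column.
    rw [← Matrix.det_submatrix_equiv_self Fin.revPerm,
      ← Matrix.det_submatrix_equiv_self Fin.revPerm B]
    refine Matrix.det_eq_of_forall_col_eq_smul_add_pred (fun _ => PowerSeries.X) ?_ ?_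
    · intro i
      simp [B]
    · intro i j
      have hj : (Fin.rev j.succ) ≠ Fin.last N := by
        rw [Ne, Fin.rev_eq_iff, Fin.rev_last]
        exact Fin.succ_ne_zero j
      simp only [Matrix.submatrix_apply, Fin.revPerm_apply, Matrix.of_apply, B, if_neg hj]
      rw [tailSeries_eq_add]
      congr 3
      have h1 := Fin.val_rev j.succ
      have h2 := Fin.val_rev j.castSucc
      have := j.2
      simp only [Fin.val_succ, Fin.val_castSucc] at h1 h2
      omega
  rw [hB, Matrix.det_eq_of_last_row, mul_comm]
  · congr 1
    · rw [jtDet, RingHom.map_det]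
      congr 1
      ext1 i j
      simp [B, Fin.castSucc_ne_last]
    · simp [B, hc]
  · intro j
    have := j.2
    simp only [B, Matrix.of_apply, if_neg (Fin.castSucc_ne_last j)]
    rw [hneg, map_zero]
    simp [hc]

/-- A sequence `ε` of column increments is allowed for `c` if `c + ε` interlaces `c`. -/
def Interlaces (c : ℕ → ℕ) (i k : ℕ) : Prop := ∀ i', i = i' + 1 → c i + k ≤ c i'

open Classical in
-- Row `i + 1` contains row `i` multiplied by `X ^ (c i - c (i + 1) + 1)`. Subtracting it leaves
-- exactly the exponents that keep `c (i + 1) + k ≤ c i`; row `0` is unrestricted.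
theorem det_tailSeries_eq_truncated {c : ℕ → ℕ} (hc : Antitone c) (N : ℕ) :
    (Matrix.of fun i j : Fin (N + 1) => tailSeries h ((c i : ℤ) - (i : ℤ) + (j : ℤ))).det =
      (Matrix.of fun i j : Fin (N + 1) => PowerSeries.mk fun k =>
        if Interlaces c i k then h (((c i + k : ℕ) : ℤ) - (i : ℤ) + (j : ℤ)) else 0).det := by
  refine Matrix.det_eq_of_forall_row_eq_smul_add_pred
    (fun i => PowerSeries.X ^ (c i - c (i + 1) + 1)) ?_ ?_
  · intro j
    ext k
    simp [tailSeries, Interlaces, add_comm, add_left_comm]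
  · intro i j
    ext k
    have hi := hc (Nat.le_succ i)
    simp only [Matrix.of_apply, map_add, PowerSeries.coeff_mk, PowerSeries.coeff_X_pow_mul',
      tailSeries, Fin.val_succ, Fin.val_castSucc, Interlaces, Nat.add_right_cancel_iff,
      forall_eq']
    by_cases hk : c (i + 1) + k ≤ c i
    · rw [if_pos hk, if_neg (by grind), add_zero]
      congr 1
      push_cast
      ring
    · rw [if_neg hk, if_pos (by grind), zero_add]
      congr 1
      have : c i - c (i + 1) + 1 ≤ k := by grind
      grind

open Classical in
/-- The Pieri rule for determinants of Jacobi--Trudi type. -/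
theorem jtDet_mul (hneg : ∀ d < 0, h d = 0) {c : ℕ → ℕ} (hc : Antitone c) {N : ℕ} (hN : c N = 0)
    (r : ℕ) :
    jtDet h c N * h r = ∑ ε ∈ finsuppAntidiag (univ : Finset (Fin (N + 1))) r with
      ∀ i : Fin (N + 1), Interlaces c i (ε i),
      (Matrix.of fun i j : Fin (N + 1) => h (((c i + ε i : ℕ) : ℤ) - (i : ℤ) + (j : ℤ))).det := by
  have key := (det_tailSeries_eq_mul hneg hN).symm.trans (det_tailSeries_eq_truncated (h := h) hc N)
  have := congrArg (PowerSeries.coeff r) key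
  rw [PowerSeries.coeff_C_mul, tailSeries, PowerSeries.coeff_mk, zero_add] at this
  -- Transposing indexes the products by rows, so the exponent `ε i` belongs to row `i` whatever the
  -- permutation.
  rw [this, ← Matrix.det_transpose, Matrix.det_apply, map_sum]
  simp_rw [Units.smul_def, map_zsmul, PowerSeries.coeff_prod, smul_sum]
  rw [sum_comm, sum_filter]
  refine sum_congr rfl fun ε _ => ?_
  simp only [Matrix.transpose_apply, Matrix.of_apply, PowerSeries.coeff_mk]
  split_ifs with hε
  · rw [← Matrix.det_transpose, Matrix.det_apply]
    simp only [hε, if_true]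
    rfl
  · push Not at hε
    obtain ⟨i, hi⟩ := hε
    refine sum_eq_zero fun σ _ => ?_
    rw [prod_eq_zero (mem_univ i), smul_zero]
    simp [hi]

end JacobiTrudi

/-! ### Young diagrams given by column lengths -/

namespace YoungDiagram

theorem colLen_eq_zero_of_card_le {ν : YoungDiagram} {j : ℕ} (hj : ν.card ≤ j) :
    ν.colLen j = 0 := by
  by_contra h
  have h1 : ((0, j) : ℕ × ℕ) ∈ ν := mem_iff_lt_colLen.2 (Nat.pos_of_ne_zero h)
  have h2 : #(ν.row 0) ≤ ν.card := card_le_card (filter_subset _ _)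
  rw [← ν.rowLen_eq_card] at h2
  have := mem_iff_lt_rowLen.1 h1
  omega

theorem rowLen_zero_le_card (ν : YoungDiagram) : ν.rowLen 0 ≤ ν.card := by
  rw [ν.rowLen_eq_card]
  exact card_le_card (filter_subset _ _)

theorem colLen_eq_zero_of_rowLen_le {ν : YoungDiagram} {j : ℕ} (hj : ν.rowLen 0 ≤ j) :
    ν.colLen j = 0 := by
  by_contra h
  have h1 : ((0, j) : ℕ × ℕ) ∈ ν := mem_iff_lt_colLen.2 (Nat.pos_of_ne_zero h)
  have := mem_iff_lt_rowLen.1 h1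
  omega

theorem card_eq_sum_colLen (ν : YoungDiagram) {N : ℕ} (hN : ν.rowLen 0 ≤ N) :
    ν.card = ∑ j ∈ range N, ν.colLen j := by
  rw [YoungDiagram.card, card_eq_sum_card_fiberwise (f := Prod.snd) (t := range N)]
  · exact sum_congr rfl fun j _ => (ν.colLen_eq_card).symm
  · rintro ⟨i, j⟩ hc
    have h1 := mem_iff_lt_rowLen.1 (show (i, j) ∈ ν from hc)
    have := ν.rowLen_anti 0 i (Nat.zero_le _)
    simp only [coe_range, Set.mem_Iio]
    omega

theorem ext_colLen {μ ν : YoungDiagram} (h : ∀ j, μ.colLen j = ν.colLen j) : μ = ν := by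
  refine SetLike.ext ?_
  rintro ⟨i, j⟩
  rw [mem_iff_lt_colLen, mem_iff_lt_colLen, h]

theorem exists_colLen_eq {f : ℕ → ℕ} (hf : Antitone f) {N : ℕ} (hN : f N = 0) :
    ∃ ν : YoungDiagram, ∀ j, ν.colLen j = f j := by
  have hz : ∀ j, N ≤ j → f j = 0 := fun j hj => by
    have := hf hj
    omega
  let ν : YoungDiagram :=
    { cells := {c ∈ range (f 0) ×ˢ range N | c.1 < f c.2}
      isLowerSet := by
        rintro ⟨i, j⟩ ⟨i', j'⟩ ⟨hi, hj⟩ h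
        simp only [coe_filter, mem_product, mem_range, Set.mem_ofPred_eq] at h hi hj ⊢
        have := hf hj
        omega }
  have hmem : ∀ i j, (i, j) ∈ ν ↔ i < f j := by
    intro i j
    rw [← mem_cells]
    simp only [ν, mem_filter, mem_product, mem_range]
    have h0 := hf (Nat.zero_le j)
    have := hz j
    constructor
    · exact fun h => h.2
    · intro h
      refine ⟨⟨by omega, ?_⟩, h⟩
      by_contra hj
      have := this (by omega)
      omega
  refine ⟨ν, fun j => le_antisymm ?_ ?_⟩
  · by_contra! h
    exact lt_irrefl _ ((hmem _ _).1 (mem_iff_lt_colLen.2 h))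
  · by_contra! h
    exact lt_irrefl _ (mem_iff_lt_colLen.1 ((hmem _ _).2 h))

/-- The skew shape `ν / μ` is a vertical strip: it has at most one cell in each row. -/
def IsVerticalStrip (μ ν : YoungDiagram) : Prop :=
  μ ≤ ν ∧ ∀ i j, (i, j + 1) ∈ ν → (i, j) ∈ μ

theorem isVerticalStrip_iff {μ ν : YoungDiagram} : μ.IsVerticalStrip ν ↔
    (∀ j, μ.colLen j ≤ ν.colLen j) ∧ ∀ j, ν.colLen (j + 1) ≤ μ.colLen j := by
  constructor
  · rintro ⟨h1, h2⟩
    constructor <;> intro j <;> by_contra! h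
    · exact lt_irrefl _ (mem_iff_lt_colLen.1 (h1 (mem_iff_lt_colLen.2 h)))
    · exact lt_irrefl _ (mem_iff_lt_colLen.1 (h2 _ _ (mem_iff_lt_colLen.2 h)))
  · rintro ⟨h1, h2⟩
    refine ⟨?_, fun i j h => ?_⟩
    · rintro ⟨i, j⟩ h
      exact mem_iff_lt_colLen.2 ((mem_iff_lt_colLen.1 h).trans_le (h1 j))
    · exact mem_iff_lt_colLen.2 ((mem_iff_lt_colLen.1 h).trans_le (h2 j))

end YoungDiagram

theorem mem_partitionsOf {m : ℕ} {ν : YoungDiagram} : ν ∈ partitionsOf m ↔ ν.card = m := by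
  simp [partitionsOf]

/-! ### The Pieri rule for Schur functions -/

theorem elemSymm_zero : elemSymm 0 = 1 := by
  classical
  refine MvPowerSeries.ext fun a => ?_
  rw [MvPowerSeries.coeff_one]
  change (if (∀ i, a i ≤ 1) ∧ (a.degree : ℤ) = 0 then (1 : ℚ) else 0) = _
  refine if_congr ⟨fun h => ?_, ?_⟩ rfl rfl
  · exact (Finsupp.degree_eq_zero_iff a).1 (by exact_mod_cast h.2)
  · rintro rfl
    simp

theorem elemSymm_of_neg {d : ℤ} (hd : d < 0) : elemSymm d = 0 := by
  classical
  refine MvPowerSeries.ext fun a => ?_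
  change (if (∀ i, a i ≤ 1) ∧ (a.degree : ℤ) = d then (1 : ℚ) else 0) = 0
  rw [if_neg]
  rintro ⟨-, h⟩
  omega

theorem schur_eq_jtDet (ν : YoungDiagram) {N : ℕ} (hN : ν.rowLen 0 ≤ N) :
    schur ν = jtDet elemSymm ν.colLen N := by
  have h1 : schur ν = jtDet elemSymm ν.colLen (SkewShape.straight ν).conj.length := by
    unfold schur jtDet SkewShape.jacobiTrudi
    congr 1
    ext1 i j
    have h2 : ((SkewShape.straight ν).conj.inner.rowLen j : ℤ) = 0 := by
      change ((⊥ : YoungDiagram).transpose.rowLen j : ℤ) = 0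
      rw [YoungDiagram.rowLen_transpose]
      exact_mod_cast YoungDiagram.colLen_eq_zero_of_card_le (Nat.zero_le _)
    have h3 : (SkewShape.straight ν).conj.outer.rowLen i = ν.colLen i :=
      YoungDiagram.rowLen_transpose _ _
    rw [Matrix.of_apply, Matrix.of_apply, h2, h3, sub_zero]
  have h2 : (SkewShape.straight ν).conj.length = ν.rowLen 0 := by
    simp [SkewShape.conj, SkewShape.straight, SkewShape.length]
  rw [h1, h2]
  exact (jtDet_eq_of_le elemSymm_zero (fun d => elemSymm_of_neg)
    (fun i hi => YoungDiagram.colLen_eq_zero_of_rowLen_le hi) hN).symm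

open Classical in
/-- The Pieri rule: `s_μ e_r` is the sum of `s_ν` over the vertical strips `ν / μ` of size `r`. -/
theorem schur_mul_elemSymm (μ : YoungDiagram) (r : ℕ) :
    schur μ * elemSymm r =
      ∑ ν ∈ partitionsOf (μ.card + r) with μ.IsVerticalStrip ν, schur ν := by
  have hμ := μ.rowLen_zero_le_card
  set N := μ.card + r with hN
  rw [schur_eq_jtDet μ (N := N) (by omega), jtDet_mul (fun d => elemSymm_of_neg)
    (fun i j hij => μ.colLen_anti i j hij) (YoungDiagram.colLen_eq_zero_of_card_le (by omega))]
  symm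
  -- A shape corresponds to its column increments over `μ`, and interlacing of the increments is the
  -- vertical strip condition. No shape of size `N` reaches beyond the first `N + 1` columns.
  refine sum_bij (fun ν _ => Finsupp.equivFunOnFinite.symm
    fun i : Fin (N + 1) => ν.colLen i - μ.colLen i) ?_ ?_ ?_ ?_
  · intro ν hν
    rw [mem_filter, mem_partitionsOf, YoungDiagram.isVerticalStrip_iff] at hν
    obtain ⟨hc, h1, h2⟩ := hν
    have hν' := ν.rowLen_zero_le_card
    simp only [mem_filter, mem_finsuppAntidiag, subset_univ, and_true,
      Finsupp.coe_equivFunOnFinite_symm]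
    constructor
    · rw [Fin.sum_univ_eq_sum_range (fun i => ν.colLen i - μ.colLen i),
        sum_tsub_distrib _ fun i _ => h1 i, ← ν.card_eq_sum_colLen (by omega),
        ← μ.card_eq_sum_colLen (by omega)]
      omega
    · intro i i' hi
      have := h1 i
      have := h2 i'
      rw [hi] at *
      omega
  · intro ν hν ν' hν' h
    rw [mem_filter, mem_partitionsOf, YoungDiagram.isVerticalStrip_iff] at hν hν'
    have h' := fun i => congrFun (Finsupp.equivFunOnFinite.symm.injective h) i
    refine YoungDiagram.ext_colLen fun j => ?_
    by_cases hj : j < N + 1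
    · have := h' ⟨j, hj⟩
      have := hν.2.1 j
      have := hν'.2.1 j
      simp only at *
      omega
    · rw [YoungDiagram.colLen_eq_zero_of_card_le, YoungDiagram.colLen_eq_zero_of_card_le] <;> omega
  · intro ε hε
    simp only [mem_filter, mem_finsuppAntidiag, subset_univ, and_true] at hε
    obtain ⟨hs, hi⟩ := hε
    let f : ℕ → ℕ := fun j => if hj : j < N + 1 then μ.colLen j + ε ⟨j, hj⟩ else 0
    have hf1 : ∀ j, f (j + 1) ≤ μ.colLen j := by
      intro j
      by_cases hj : j + 1 < N + 1
      · simp only [f, dif_pos hj]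
        exact hi ⟨j + 1, hj⟩ j rfl
      · simp only [f, dif_neg hj, Nat.zero_le]
    have hf2 : ∀ j, μ.colLen j ≤ f j := by
      intro j
      by_cases hj : j < N + 1
      · simp only [f, dif_pos hj, Nat.le_add_right]
      · rw [YoungDiagram.colLen_eq_zero_of_card_le (by omega)]
        exact Nat.zero_le _
    obtain ⟨ν, hν⟩ := YoungDiagram.exists_colLen_eq (f := f)
      (antitone_nat_of_succ_le fun j => (hf1 j).trans (hf2 j)) (N := N + 1) (by simp [f])
    have hr : ν.rowLen 0 ≤ N + 1 := by
      by_contra! h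
      have h1 := YoungDiagram.mem_iff_lt_colLen.1 (YoungDiagram.mem_iff_lt_rowLen.2 h)
      simp [hν, f] at h1
    refine ⟨ν, ?_, ?_⟩
    · rw [mem_filter, mem_partitionsOf, YoungDiagram.isVerticalStrip_iff]
      refine ⟨?_, fun j => hν j ▸ hf2 j, fun j => hν (j + 1) ▸ hf1 j⟩
      rw [ν.card_eq_sum_colLen hr, ← Fin.sum_univ_eq_sum_range]
      simp only [hν, f, Fin.is_lt, dif_pos, Fin.eta, sum_add_distrib, hs]
      rw [Fin.sum_univ_eq_sum_range (fun i => μ.colLen i), ← μ.card_eq_sum_colLen (by omega)]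
    · ext i
      simp only [Finsupp.coe_equivFunOnFinite_symm, hν, f, Fin.is_lt, dif_pos, Fin.eta,
        Nat.add_sub_cancel_left]
  · intro ν hν
    rw [mem_filter, mem_partitionsOf, YoungDiagram.isVerticalStrip_iff] at hν
    have := ν.rowLen_zero_le_card
    rw [schur_eq_jtDet ν (N := N + 1) (by omega), jtDet]
    congr 1
    ext1 i j
    have := hν.2.1 i
    simp only [Matrix.of_apply, Finsupp.coe_equivFunOnFinite_symm, Nat.add_sub_cancel' this]

/-! ### Standard tableaux with prescribed descents and vertical strips -/

namespace SemistandardYoungTableau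

variable {μ ν : YoungDiagram}

theorem IsStandard.entry_mem {T : SemistandardYoungTableau ν} (hT : T.IsStandard) {c : ℕ × ℕ}
    (hc : c ∈ ν) : 1 ≤ T c.1 c.2 ∧ T c.1 c.2 ≤ ν.card :=
  hT.mapsTo hc

theorem IsStandard.eq_of_entry_eq {T : SemistandardYoungTableau ν} (hT : T.IsStandard)
    {c d : ℕ × ℕ} (hc : c ∈ ν) (hd : d ∈ ν) (h : T c.1 c.2 = T d.1 d.2) : c = d :=
  hT.injOn hc hd h

theorem IsStandard.exists_entry_eq {T : SemistandardYoungTableau ν} (hT : T.IsStandard) {k : ℕ}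
    (h1 : 1 ≤ k) (h2 : k ≤ ν.card) : ∃ c ∈ ν, T c.1 c.2 = k :=
  hT.surjOn ⟨h1, h2⟩

theorem IsStandard.descentSet_subset {T : SemistandardYoungTableau ν} (hT : T.IsStandard) :
    T.descentSet ⊆ Set.Icc 1 (ν.card - 1) := by
  rintro i ⟨c, hc, d, hd, h1, h2, -⟩
  have := hT.entry_mem hc
  have := hT.entry_mem hd
  simp only [Set.mem_Icc]
  omega

theorem IsStandard.card_entries {T : SemistandardYoungTableau ν} (hT : T.IsStandard) {a b : ℕ}
    (hb : b ≤ ν.card) : #{c ∈ ν.cells | a < T c.1 c.2 ∧ T c.1 c.2 ≤ b} = b - a := by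
  rw [← Nat.card_Ioc]
  refine card_bij (fun c _ => T c.1 c.2) ?_ ?_ ?_
  · intro c hc
    rw [mem_Ioc]
    exact (mem_filter.1 hc).2
  · intro c hc d hd h
    exact hT.eq_of_entry_eq (mem_filter.1 hc).1 (mem_filter.1 hd).1 h
  · intro k hk
    rw [mem_Ioc] at hk
    obtain ⟨c, hc, rfl⟩ := hT.exists_entry_eq (by omega) (hk.2.trans hb)
    exact ⟨c, mem_filter.2 ⟨hc, hk⟩, rfl⟩

/-- The cells of a tableau with entry at most `n`. -/
def truncShape (T : SemistandardYoungTableau ν) (n : ℕ) : YoungDiagram where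
  cells := {c ∈ ν.cells | T c.1 c.2 ≤ n}
  isLowerSet := by
    rintro ⟨i, j⟩ ⟨i', j'⟩ ⟨hi, hj⟩ h
    simp only [coe_filter, YoungDiagram.mem_cells, Set.mem_ofPred_eq] at h ⊢
    simp only at hi hj
    exact ⟨ν.up_left_mem hi hj h.1, ((T.col_weak hi (ν.up_left_mem le_rfl hj h.1)).trans
      (T.row_weak_of_le hj h.1)).trans h.2⟩

theorem mem_truncShape {T : SemistandardYoungTableau ν} {n : ℕ} {c : ℕ × ℕ} :
    c ∈ T.truncShape n ↔ c ∈ ν ∧ T c.1 c.2 ≤ n := by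
  rw [← YoungDiagram.mem_cells]
  simp [truncShape]

theorem IsStandard.card_truncShape {T : SemistandardYoungTableau ν} (hT : T.IsStandard) {n : ℕ}
    (hn : n ≤ ν.card) : (T.truncShape n).card = n := by
  have h := hT.card_entries (a := 0) hn
  rw [Nat.sub_zero] at h
  refine Eq.trans (congrArg card (filter_congr fun c hc => ?_)) h
  have := hT.entry_mem hc
  omega

/-- Restriction of a tableau to a smaller shape. -/
def restrict (T : SemistandardYoungTableau ν) (h : μ ≤ ν) : SemistandardYoungTableau μ where
  entry i j := if (i, j) ∈ μ then T i j else 0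
  row_weak' hj hcell := by
    rw [if_pos hcell, if_pos (μ.up_left_mem le_rfl hj.le hcell)]
    exact T.row_weak hj (h hcell)
  col_strict' hi hcell := by
    rw [if_pos hcell, if_pos (μ.up_left_mem hi.le le_rfl hcell)]
    exact T.col_strict hi (h hcell)
  zeros' hcell := if_neg hcell

theorem restrict_apply (T : SemistandardYoungTableau ν) (h : μ ≤ ν) {i j : ℕ} (hc : (i, j) ∈ μ) :
    T.restrict h i j = T i j :=
  if_pos hc

/-- Every value from `T c` up to `T d - 1` is a descent, so each successive entry lies in a strictly
lower row. -/
theorem IsStandard.row_lt_row {T : SemistandardYoungTableau ν} (hT : T.IsStandard) {n : ℕ}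
    (hD : Set.Ioo n ν.card ⊆ T.descentSet) {c d : ℕ × ℕ} (hc : c ∈ ν) (hd : d ∈ ν)
    (hn : n < T c.1 c.2) (hcd : T c.1 c.2 < T d.1 d.2) : c.1 < d.1 := by
  obtain ⟨k, hk⟩ := Nat.exists_eq_add_of_lt hcd
  induction k generalizing d with
  | zero =>
    have := hT.entry_mem hd
    obtain ⟨c', hc', d', hd', h1, h2, h3⟩ := hD ⟨hn, by omega⟩
    rwa [hT.eq_of_entry_eq hc' hc h1, hT.eq_of_entry_eq hd' hd (by omega)] at h3
  | succ k ih =>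
    have hd1 := hT.entry_mem hd
    obtain ⟨e, he, he'⟩ := hT.exists_entry_eq (k := T c.1 c.2 + k + 1) (by omega) (by omega)
    have h1 := ih he (by omega) he'
    obtain ⟨c', hc', d', hd', h1', h2, h3⟩ := hD (a := T c.1 c.2 + k + 1) ⟨by omega, by omega⟩
    rw [hT.eq_of_entry_eq hc' he (by omega), hT.eq_of_entry_eq hd' hd (by omega)] at h3
    omega

theorem IsStandard.isVerticalStrip_truncShape {T : SemistandardYoungTableau ν}
    (hT : T.IsStandard) {n : ℕ} (hD : Set.Ioo n ν.card ⊆ T.descentSet) :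
    (T.truncShape n).IsVerticalStrip ν := by
  refine ⟨fun c hc => (mem_truncShape.1 hc).1, fun i j hc => ?_⟩
  have hc' : (i, j) ∈ ν := ν.up_left_mem le_rfl (Nat.le_succ j) hc
  refine mem_truncShape.2 ⟨hc', ?_⟩
  by_contra! h
  have h1 := T.row_weak (Nat.lt_succ_self j) hc
  rcases h1.lt_or_eq with h1 | h1
  · exact lt_irrefl _ (hT.row_lt_row (c := (i, j)) (d := (i, j + 1)) hD hc' hc h h1)
  · simpa using hT.eq_of_entry_eq hc' hc h1

/-- The number of cells of `ν / μ` in the first `i + 1` rows. -/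
def stripRank (μ ν : YoungDiagram) (i : ℕ) : ℕ := #{d ∈ ν.cells \ μ.cells | d.1 ≤ i}

theorem stripRank_mono {i j : ℕ} (h : i ≤ j) : stripRank μ ν i ≤ stripRank μ ν j :=
  card_le_card (monotone_filter_right _ fun _ _ hd => hd.trans h)

theorem stripRank_lt {i : ℕ} {d : ℕ × ℕ} (hd : d ∈ ν) (hd' : d ∉ μ) (h : i < d.1) :
    stripRank μ ν i < stripRank μ ν d.1 := by
  refine card_lt_card ((ssubset_iff_of_subset
    (monotone_filter_right _ fun _ _ hd => hd.trans h.le)).2 ⟨d, ?_, ?_⟩)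
  · simp [hd, hd']
  · simp [h]

theorem stripRank_pos {d : ℕ × ℕ} (hd : d ∈ ν) (hd' : d ∉ μ) : 0 < stripRank μ ν d.1 :=
  card_pos.2 ⟨d, by simp [hd, hd']⟩

theorem stripRank_le (h : μ ≤ ν) (i : ℕ) : μ.card + stripRank μ ν i ≤ ν.card := by
  have h1 : stripRank μ ν i ≤ #(ν.cells \ μ.cells) := card_filter_le _ _
  rw [card_sdiff_of_subset (YoungDiagram.cells_subset_iff.2 h)] at h1
  have := card_le_card (YoungDiagram.cells_subset_iff.2 h)
  simp only [YoungDiagram.card]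
  omega

/-- Entries above `n` run from top to bottom, so they are forced by the shape of the strip. Hence
restriction to the entries at most `n` loses no information. -/
theorem IsStandard.entry_eq_stripRank {T : SemistandardYoungTableau ν} (hT : T.IsStandard) {n : ℕ}
    (hD : Set.Ioo n ν.card ⊆ T.descentSet) {c : ℕ × ℕ} (hc : c ∈ ν) (hn : n < T c.1 c.2) :
    T c.1 c.2 = n + stripRank (T.truncShape n) ν c.1 := by
  have h1 := hT.card_entries (a := n) (hT.entry_mem hc).2
  have h2 : stripRank (T.truncShape n) ν c.1 =
      #{d ∈ ν.cells | n < T d.1 d.2 ∧ T d.1 d.2 ≤ T c.1 c.2} := by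
    rw [stripRank]
    congr 1
    ext d
    simp only [mem_filter, mem_sdiff, YoungDiagram.mem_cells, mem_truncShape]
    constructor
    · rintro ⟨⟨hd, h⟩, hdc⟩
      have hd' : n < T d.1 d.2 := by
        by_contra! h'
        exact h ⟨hd, h'⟩
      refine ⟨hd, hd', ?_⟩
      by_contra! h'
      have := hT.row_lt_row hD hc hd hn h'
      omega
    · rintro ⟨hd, hd1, hd2⟩
      refine ⟨⟨hd, fun h => by omega⟩, ?_⟩
      rcases hd2.lt_or_eq with h | h
      · exact (hT.row_lt_row hD hd hc hd1 h).le
      · rw [hT.eq_of_entry_eq hd hc h]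
  omega

/-- Extension of a tableau by a vertical strip, filled from top to bottom. -/
def extend (T : SemistandardYoungTableau μ) (hT : T.IsStandard) (h : μ.IsVerticalStrip ν) :
    SemistandardYoungTableau ν where
  entry i j := if (i, j) ∈ μ then T i j else if (i, j) ∈ ν then μ.card + stripRank μ ν i else 0
  row_weak' := by
    intro i j1 j2 hj hcell
    have h1 : (i, j1) ∈ μ := by
      obtain ⟨j, rfl⟩ := Nat.exists_eq_add_of_lt hj
      exact μ.up_left_mem le_rfl (Nat.le_add_right _ _) (h.2 _ _ hcell)
    rw [if_pos h1]
    split_ifs with h2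
    · exact T.row_weak hj h2
    · exact (hT.entry_mem h1).2.trans (Nat.le_add_right _ _)
  col_strict' := by
    intro i1 i2 j hi hcell
    by_cases h2 : (i2, j) ∈ μ
    · rw [if_pos h2, if_pos (μ.up_left_mem hi.le le_rfl h2)]
      exact T.col_strict hi h2
    · rw [if_neg h2, if_pos hcell]
      split_ifs with h1 h3
      · have := (hT.entry_mem h1).2
        have := stripRank_pos hcell h2
        simp only at *
        omega
      · exact Nat.add_lt_add_left (stripRank_lt hcell h2 hi) _
      · exact absurd (ν.up_left_mem hi.le le_rfl hcell) h3
  zeros' := by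
    intro i j hc
    rw [if_neg fun h' => hc (h.1 h'), if_neg hc]

theorem extend_of_mem {T : SemistandardYoungTableau μ} (hT : T.IsStandard)
    (h : μ.IsVerticalStrip ν) {c : ℕ × ℕ} (hc : c ∈ μ) : T.extend hT h c.1 c.2 = T c.1 c.2 :=
  if_pos hc

theorem extend_of_notMem {T : SemistandardYoungTableau μ} (hT : T.IsStandard)
    (h : μ.IsVerticalStrip ν) {c : ℕ × ℕ} (hc : c ∉ μ) (hc' : c ∈ ν) :
    T.extend hT h c.1 c.2 = μ.card + stripRank μ ν c.1 :=
  (if_neg hc).trans (if_pos hc')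

theorem extend_le_iff {T : SemistandardYoungTableau μ} (hT : T.IsStandard)
    (h : μ.IsVerticalStrip ν) {c : ℕ × ℕ} (hc : c ∈ ν) :
    T.extend hT h c.1 c.2 ≤ μ.card ↔ c ∈ μ := by
  constructor
  · intro h1
    by_contra hc'
    rw [extend_of_notMem hT h hc' hc] at h1
    have := stripRank_pos hc hc'
    omega
  · intro hc'
    rw [extend_of_mem hT h hc']
    exact (hT.entry_mem hc').2

theorem truncShape_extend {T : SemistandardYoungTableau μ} (hT : T.IsStandard)
    (h : μ.IsVerticalStrip ν) : (T.extend hT h).truncShape μ.card = μ := by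
  refine SetLike.ext fun c => ?_
  rw [mem_truncShape]
  constructor
  · exact fun hc => (extend_le_iff hT h hc.1).1 hc.2
  · exact fun hc => ⟨h.1 hc, (extend_le_iff hT h (h.1 hc)).2 hc⟩

theorem isStandard_extend {T : SemistandardYoungTableau μ} (hT : T.IsStandard)
    (h : μ.IsVerticalStrip ν) : (T.extend hT h).IsStandard := by
  have hmaps : Set.MapsTo (fun c : ℕ × ℕ => T.extend hT h c.1 c.2) (ν.cells : Set (ℕ × ℕ))
      (Set.Icc 1 ν.card) := by
    intro c hc
    by_cases hc' : c ∈ μ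
    · simp only [extend_of_mem hT h hc']
      have := hT.entry_mem hc'
      exact ⟨this.1, this.2.trans (card_le_card (YoungDiagram.cells_subset_iff.2 h.1))⟩
    · simp only [extend_of_notMem hT h hc' hc]
      have := stripRank_pos hc hc'
      exact ⟨by omega, stripRank_le h.1 _⟩
  have hinj : Set.InjOn (fun c : ℕ × ℕ => T.extend hT h c.1 c.2) (ν.cells : Set (ℕ × ℕ)) := by
    intro c hc d hd hcd
    simp only at hcd
    have hiff : c ∈ μ ↔ d ∈ μ := by
      rw [← extend_le_iff hT h hc, ← extend_le_iff hT h hd, hcd]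
    by_cases hc' : c ∈ μ
    · have hd' := hiff.1 hc'
      rw [extend_of_mem hT h hc', extend_of_mem hT h hd'] at hcd
      exact hT.eq_of_entry_eq hc' hd' hcd
    · have hd' := fun hd' => hc' (hiff.2 hd')
      rw [extend_of_notMem hT h hc' hc, extend_of_notMem hT h hd' hd] at hcd
      have hrow : c.1 = d.1 := by
        rcases lt_trichotomy c.1 d.1 with hlt | heq | hlt
        · have := stripRank_lt hd hd' hlt
          omega
        · exact heq
        · have := stripRank_lt hc hc' hlt
          omega
      have key : ∀ i j j', (i, j) ∉ μ → (i, j') ∈ ν → ¬ j < j' := by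
        intro i j j' h1 h2 hj
        obtain ⟨k, rfl⟩ := Nat.exists_eq_add_of_lt hj
        exact h1 (μ.up_left_mem le_rfl (Nat.le_add_right _ _) (h.2 _ _ h2))
      obtain ⟨i, j⟩ := c
      obtain ⟨i', j'⟩ := d
      obtain rfl : i = i' := hrow
      have := key i j j' hc' hd
      have := key i j' j hd' hc
      rw [Prod.mk.injEq]
      omega
  refine ⟨hmaps, hinj, ?_⟩
  rw [← coe_Icc] at hmaps ⊢
  exact surjOn_of_injOn_of_card_le _ hmaps hinj (by simp [YoungDiagram.card])

theorem descentSet_subset_extend {T : SemistandardYoungTableau μ} (hT : T.IsStandard)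
    (h : μ.IsVerticalStrip ν) : T.descentSet ⊆ (T.extend hT h).descentSet := by
  rintro i ⟨c, hc, d, hd, h1, h2, h3⟩
  refine ⟨c, h.1 hc, d, h.1 hd, ?_, ?_, h3⟩
  · rwa [extend_of_mem hT h hc]
  · rwa [extend_of_mem hT h hd]

theorem Ioo_subset_descentSet_extend {T : SemistandardYoungTableau μ} (hT : T.IsStandard)
    (h : μ.IsVerticalStrip ν) : Set.Ioo μ.card ν.card ⊆ (T.extend hT h).descentSet := by
  rintro i ⟨hi1, hi2⟩
  have hs := isStandard_extend hT h
  obtain ⟨c, hc, hc1⟩ := hs.exists_entry_eq (k := i) (by omega) (by omega)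
  obtain ⟨d, hd, hd1⟩ := hs.exists_entry_eq (k := i + 1) (by omega) (by omega)
  refine ⟨c, hc, d, hd, hc1, hd1, ?_⟩
  by_contra! hle
  have hc' : c ∉ μ := by
    rw [← extend_le_iff hT h hc]
    omega
  have hd' : d ∉ μ := by
    rw [← extend_le_iff hT h hd]
    omega
  rw [extend_of_notMem hT h hc' hc] at hc1
  rw [extend_of_notMem hT h hd' hd] at hd1
  have := stripRank_mono (μ := μ) (ν := ν) hle
  omega

theorem IsStandard.isStandard_restrict {T : SemistandardYoungTableau ν} (hT : T.IsStandard)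
    {n : ℕ} (hn : n ≤ ν.card) (h : T.truncShape n ≤ ν) : (T.restrict h).IsStandard := by
  rw [IsStandard, hT.card_truncShape hn]
  refine ⟨fun c hc => ?_, fun c hc d hd hcd => ?_, fun k hk => ?_⟩
  · simp only [T.restrict_apply h hc]
    exact ⟨(hT.entry_mem (h hc)).1, (mem_truncShape.1 hc).2⟩
  · simp only [T.restrict_apply h hc, T.restrict_apply h hd] at hcd
    exact hT.eq_of_entry_eq (h hc) (h hd) hcd
  · obtain ⟨c, hc, hck⟩ := hT.exists_entry_eq hk.1 (hk.2.trans hn)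
    have hc' : c ∈ T.truncShape n := mem_truncShape.2 ⟨hc, hck ▸ hk.2⟩
    exact ⟨c, hc', (T.restrict_apply h hc').trans hck⟩

theorem subset_descentSet_restrict {T : SemistandardYoungTableau ν}
    {n : ℕ} (h : T.truncShape n ≤ ν) {D : Set ℕ} (hD : D ⊆ Set.Icc 1 (n - 1))
    (hDT : D ⊆ T.descentSet) : D ⊆ (T.restrict h).descentSet := by
  intro i hi
  have hi' := hD hi
  obtain ⟨c, hc, d, hd, h1, h2, h3⟩ := hDT hi
  simp only [Set.mem_Icc] at hi'
  have hc' : c ∈ T.truncShape n := mem_truncShape.2 ⟨hc, by omega⟩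
  have hd' : d ∈ T.truncShape n := mem_truncShape.2 ⟨hd, by omega⟩
  exact ⟨c, hc', d, hd', (T.restrict_apply h hc').trans h1, (T.restrict_apply h hd').trans h2, h3⟩

end SemistandardYoungTableau

/-! ### Counting tableaux by descents and their generating functions -/

open SemistandardYoungTableau

/-- The number of standard Young tableaux of shape `ν` whose descent set contains `D`. -/
def numSYTContaining (ν : YoungDiagram) (D : Finset ℕ) : ℕ :=
  {T : SemistandardYoungTableau ν | T.IsStandard ∧ (D : Set ℕ) ⊆ T.descentSet}.ncard

open Classical in
theorem numSYTContaining_eq_sum_numSYT (ν : YoungDiagram) (D : Finset ℕ) :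
    numSYTContaining ν D = ∑ A ∈ (Icc 1 (ν.card - 1)).powerset with D ⊆ A, numSYT ν A := by
  have hfin := finite_setOf_isStandard ν
  have hf : {T : SemistandardYoungTableau ν | T.IsStandard ∧ (D : Set ℕ) ⊆ T.descentSet}.Finite :=
    hfin.subset fun T hT => hT.1
  have hds : ∀ T : SemistandardYoungTableau ν, T.IsStandard → T.descentSet.Finite := fun T hT =>
    (Set.finite_Icc _ _).subset hT.descentSet_subset
  rw [numSYTContaining, Set.ncard_eq_toFinset_card _ hf,
    card_eq_sum_card_fiberwise (f := fun T => {i ∈ Icc 1 (ν.card - 1) | i ∈ T.descentSet})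
      (t := {A ∈ (Icc 1 (ν.card - 1)).powerset | D ⊆ A})]
  · refine sum_congr rfl fun A hA => ?_
    rw [numSYT, ← Set.ncard_coe_finset]
    congr 1
    ext T
    simp only [coe_filter, Set.Finite.mem_toFinset, Set.mem_ofPred_eq]
    have hco : T.IsStandard → (({i ∈ Icc 1 (ν.card - 1) | i ∈ T.descentSet} : Finset ℕ) : Set ℕ)
        = T.descentSet := fun hT => by
      ext i
      have := @IsStandard.descentSet_subset _ _ hT i
      simp only [Set.mem_Icc] at this
      simpa using this
    constructor
    · rintro ⟨⟨h1, h2⟩, h3⟩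
      exact ⟨h1, by rw [← hco h1, h3]⟩
    · rintro ⟨h1, h2⟩
      refine ⟨⟨h1, h2 ▸ ?_⟩, ?_⟩
      · exact_mod_cast (mem_filter.1 hA).2
      · exact_mod_cast (hco h1).trans h2
  · intro T hT
    simp only [Set.Finite.coe_toFinset, Set.mem_ofPred_eq] at hT
    simp only [coe_filter, mem_powerset, Set.mem_ofPred_eq]
    refine ⟨filter_subset _ _, fun i hi => ?_⟩
    have := hT.1.descentSet_subset (hT.2 hi)
    exact mem_filter.2 ⟨by simpa using this, hT.2 hi⟩

open Classical in
-- The tableaux are fibred over the shape occupied by the entries at most `n`. On each fibre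
-- restriction is a bijection, with inverse `extend`.
theorem numSYTContaining_union_Ioo {ν : YoungDiagram} {n : ℕ} (hn : n ≤ ν.card) {D : Finset ℕ}
    (hD : D ⊆ Icc 1 (n - 1)) :
    numSYTContaining ν (D ∪ Ioo n ν.card) =
      ∑ μ ∈ partitionsOf n with μ.IsVerticalStrip ν, numSYTContaining μ D := by
  have hD' : (D : Set ℕ) ⊆ Set.Icc 1 (n - 1) := by
    rw [← coe_Icc]
    exact coe_subset.2 hD
  have hf : {T : SemistandardYoungTableau ν | T.IsStandard ∧
      ((D ∪ Ioo n ν.card : Finset ℕ) : Set ℕ) ⊆ T.descentSet}.Finite :=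
    (finite_setOf_isStandard ν).subset fun T hT => hT.1
  rw [numSYTContaining, Set.ncard_eq_toFinset_card _ hf,
    card_eq_sum_card_fiberwise (f := fun T => T.truncShape n)
      (t := {μ ∈ partitionsOf n | μ.IsVerticalStrip ν})]
  · refine sum_congr rfl fun μ hμ => ?_
    rw [mem_filter, mem_partitionsOf] at hμ
    obtain ⟨hcard, hstrip⟩ := hμ
    rw [← Set.ncard_coe_finset, numSYTContaining]
    have hmem : ∀ T : SemistandardYoungTableau ν,
        T ∈ (({T ∈ hf.toFinset | T.truncShape n = μ} : Finset _) : Set _) ↔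
        (T.IsStandard ∧ (D : Set ℕ) ⊆ T.descentSet ∧ Set.Ioo n ν.card ⊆ T.descentSet) ∧
          T.truncShape n = μ := by
      intro T
      simp [Set.union_subset_iff]
    refine Set.ncard_congr (fun T _ => T.restrict hstrip.1) ?_ ?_ ?_
    · intro T hT
      obtain ⟨⟨h1, h2, h3⟩, rfl⟩ := (hmem T).1 hT
      exact ⟨h1.isStandard_restrict hn _, subset_descentSet_restrict _ hD' h2⟩
    · intro T S hT hS hTS
      obtain ⟨⟨h1, h2, h3⟩, h4⟩ := (hmem T).1 hT
      obtain ⟨⟨h1', h2', h3'⟩, h4'⟩ := (hmem S).1 hS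
      ext i j
      by_cases hc : (i, j) ∈ μ
      · rw [← T.restrict_apply hstrip.1 hc, ← S.restrict_apply hstrip.1 hc, hTS]
      · by_cases hc' : (i, j) ∈ ν
        · have hTn : n < T i j := by
            by_contra! h
            exact hc (h4 ▸ mem_truncShape.2 ⟨hc', h⟩)
          have hSn : n < S i j := by
            by_contra! h
            exact hc (h4' ▸ mem_truncShape.2 ⟨hc', h⟩)
          have e1 := h1.entry_eq_stripRank h3 hc' hTn
          have e2 := h1'.entry_eq_stripRank h3' hc' hSn
          rw [h4] at e1
          rw [h4'] at e2
          exact e1.trans e2.symm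
        · rw [T.zeros hc', S.zeros hc']
    · rintro T ⟨hT, hTD⟩
      refine ⟨T.extend hT hstrip, (hmem _).2 ⟨⟨isStandard_extend hT hstrip,
        hTD.trans (descentSet_subset_extend hT hstrip), ?_⟩, ?_⟩, ?_⟩
      · rw [← hcard]
        exact Ioo_subset_descentSet_extend hT hstrip
      · rw [← hcard]
        exact truncShape_extend hT hstrip
      · ext i j
        by_cases hc : (i, j) ∈ μ
        · rw [restrict_apply _ _ hc]
          exact extend_of_mem hT hstrip hc
        · rw [zeros _ hc, zeros _ hc]
  · intro T hT
    simp only [coe_union, coe_Ioo, Set.union_subset_iff, Set.Finite.coe_toFinset,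
      Set.mem_ofPred_eq] at hT
    simp only [coe_filter, mem_partitionsOf, Set.mem_ofPred_eq]
    exact ⟨hT.1.card_truncShape hn, hT.1.isVerticalStrip_truncShape hT.2.2⟩

/-- The generating function of the tableaux of size `m` whose descent set contains `D`. -/
def schurDescentSum (m : ℕ) (D : Finset ℕ) : MvPowerSeries ℕ ℚ :=
  ∑ ν ∈ partitionsOf m, numSYTContaining ν D • schur ν

/-- Vertical strips `ν / μ` govern both the tableau extensions and the Pieri rule, so exchanging the
sums over `μ` and `ν` suffices. With the value at size `0`, this is all that the determinant
expansion needs to know about tableaux. -/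
theorem schurDescentSum_union_Ioo {n m : ℕ} (hnm : n ≤ m) {D : Finset ℕ}
    (hD : D ⊆ Icc 1 (n - 1)) :
    schurDescentSum m (D ∪ Ioo n m) = schurDescentSum n D * elemSymm ((m - n : ℕ) : ℤ) := by
  classical
  rw [schurDescentSum, schurDescentSum, sum_mul]
  have h1 : ∀ ν ∈ partitionsOf m, numSYTContaining ν (D ∪ Ioo n m) • schur ν =
      ∑ μ ∈ partitionsOf n, if μ.IsVerticalStrip ν then numSYTContaining μ D • schur ν else 0 := by
    intro ν hν
    rw [mem_partitionsOf] at hν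
    subst hν
    rw [numSYTContaining_union_Ioo hnm hD, sum_smul, sum_filter]
  rw [sum_congr rfl h1, sum_comm]
  refine sum_congr rfl fun μ hμ => ?_
  rw [mem_partitionsOf] at hμ
  rw [smul_mul_assoc, schur_mul_elemSymm, hμ, Nat.add_sub_cancel' hnm, smul_sum, sum_filter]

theorem numSYTContaining_empty_of_card_eq_zero {ν : YoungDiagram} (hν : ν.card = 0) :
    numSYTContaining ν ∅ = 1 := by
  have hc : ∀ c, c ∉ ν := fun c hc => by
    have : 0 < ν.card := card_pos.2 ⟨c, hc⟩
    omega
  rw [numSYTContaining, Set.ncard_eq_one]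
  refine ⟨SemistandardYoungTableau.highestWeight ν, ?_⟩
  ext T
  simp only [coe_empty, Set.empty_subset, and_true, Set.mem_ofPred_eq, Set.mem_singleton_iff]
  constructor
  · intro _
    ext i j
    rw [T.zeros (hc _), zeros _ (hc _)]
  · rintro rfl
    have he : (ν.cells : Set (ℕ × ℕ)) = ∅ := by
      ext c
      simpa using hc c
    rw [IsStandard, hν, he]
    simp

theorem schurDescentSum_zero : schurDescentSum 0 ∅ = 1 := by
  have h : partitionsOf 0 = {⊥} := by
    ext ν
    rw [mem_partitionsOf, mem_singleton, YoungDiagram.card, card_eq_zero,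
      ← YoungDiagram.cells_bot, YoungDiagram.ext_iff]
  have hb : (⊥ : YoungDiagram).rowLen 0 ≤ 0 := by
    by_contra! h
    exact YoungDiagram.notMem_bot _ (YoungDiagram.mem_iff_lt_rowLen.2 h)
  rw [schurDescentSum, h, sum_singleton, numSYTContaining_empty_of_card_eq_zero rfl, one_smul,
    schur_eq_jtDet _ hb, jtDet, Matrix.det_fin_zero]

/-! ### Hessenberg determinants as alternating sums -/

section Hessenberg

variable {B : Type*} [CommRing B]

/-- The alternating sum of `G m (Ioo 0 m \ T)` over the subsets `T` of `C`. -/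
def alternatingCutSum (G : ℕ → Finset ℕ → B) (m : ℕ) (C : Finset ℕ) : B :=
  ∑ T ∈ C.powerset, (-1) ^ (#C + #T) * G m (Ioo 0 m \ T)

/-- Split the subsets by whether they contain `n`. Since `n` exceeds all of `C`, those with `n`
split off a last block of length `m - n`; those without it only change sign, as the ambient set has
grown by one. -/
theorem alternatingCutSum_insert {G : ℕ → Finset ℕ → B} {g : ℤ → B}
    (hG : ∀ n m D, n ≤ m → D ⊆ Icc 1 (n - 1) → G m (D ∪ Ioo n m) = G n D * g ((m - n : ℕ) : ℤ))
    {m n : ℕ} (hn : 0 < n) (hnm : n < m) {C : Finset ℕ} (hC : ∀ c ∈ C, c < n) :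
    alternatingCutSum G m (insert n C) =
      alternatingCutSum G n C * g ((m - n : ℕ) : ℤ) - alternatingCutSum G m C := by
  have hnC : n ∉ C := fun h => lt_irrefl _ (hC n h)
  rw [alternatingCutSum, sum_powerset_insert hnC, card_insert_of_notMem hnC, add_comm,
    sub_eq_add_neg, alternatingCutSum, alternatingCutSum, sum_mul, ← sum_neg_distrib]
  congr 1
  · refine sum_congr rfl fun T hT => ?_
    rw [mem_powerset] at hT
    have hset : Ioo 0 m \ insert n T = (Ioo 0 n \ T) ∪ Ioo n m := by
      ext i
      simp only [mem_sdiff, mem_union, mem_Ioo, mem_insert]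
      have : i ∈ T → i < n := fun hi => hC i (hT hi)
      grind
    rw [card_insert_of_notMem fun h => hnC (hT h), hset, hG _ _ _ hnm.le]
    · ring
    · intro i hi
      simp only [mem_sdiff, mem_Ioo, mem_Icc] at hi ⊢
      omega
  · refine sum_congr rfl fun T hT => ?_
    ring

/-- A Hessenberg determinant `det (g (w_i - w_{j+1}))` is an alternating sum over the subsets of
`{w_1, …, w_k}`. -/
theorem det_eq_alternatingCutSum {G : ℕ → Finset ℕ → B} {g : ℤ → B}
    (hG : ∀ n m D, n ≤ m → D ⊆ Icc 1 (n - 1) → G m (D ∪ Ioo n m) = G n D * g ((m - n : ℕ) : ℤ))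
    (hG0 : G 0 ∅ = 1) (g0 : g 0 = 1) (gneg : ∀ d < 0, g d = 0) (k : ℕ) (w : ℕ → ℕ)
    (hw : ∀ i ≤ k, w (i + 1) < w i) (hw0 : w (k + 1) = 0) :
    (Matrix.of fun i j : Fin (k + 1) => g ((w i : ℤ) - (w (j + 1) : ℤ))).det =
      alternatingCutSum G (w 0) ((range k).image fun i => w (i + 1)) := by
  induction k generalizing w with
  | zero =>
    have := hG 0 (w 0) ∅ (Nat.zero_le _) (empty_subset _)
    rw [empty_union, hG0, one_mul, Nat.sub_zero] at this
    simp [alternatingCutSum, this, hw0]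
  | succ k ih =>
    have hlt : ∀ i ≤ k, w (i + 2) < w 1 := by
      intro i hi
      induction i with
      | zero => exact hw 1 (by omega)
      | succ i ihi => exact (hw (i + 2) (by omega)).trans (ihi (by omega))
    have h01 := hw 0 (by omega)
    -- The two minors that survive belong to the sequence `w` with `w 0` omitted and with `w 1`
    -- omitted.
    have h1 := ih (fun i => w (i + 1)) (fun i hi => hw (i + 1) (by omega)) hw0
    have h2 := ih (fun i => if i = 0 then w 0 else w (i + 1))
      (fun i hi => by
        rcases i with _ | i
        · exact (hw 1 (by omega)).trans h01
        · exact hw (i + 2) (by omega)) hw0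
    have hC : ((range (k + 1)).image fun i => w (i + 1)) =
        insert (w 1) ((range k).image fun i => w (i + 1 + 1)) := by
      rw [range_eq_Ico, ← Finset.insert_Ico_add_one_left_eq_Ico (Nat.succ_pos k), image_insert]
      congr 1
      ext x
      simp only [mem_image, mem_Ico, mem_range]
      constructor
      · rintro ⟨i, hi, rfl⟩
        exact ⟨i - 1, by omega, by rw [Nat.sub_add_cancel (by omega)]⟩
      · rintro ⟨i, hi, rfl⟩
        exact ⟨i + 1, by omega, rfl⟩
    rw [hC, alternatingCutSum_insert hG (lt_of_le_of_lt (Nat.zero_le _) (hlt 0 (Nat.zero_le _)))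
      h01 (by
        intro c hc
        obtain ⟨i, hi, rfl⟩ := mem_image.1 hc
        exact hlt i (mem_range.1 hi).le)]
    simp only [Nat.add_eq_zero_iff, one_ne_zero, and_false, if_false, if_true] at h2
    -- The first column is `g (w 0 - w 1), 1, 0, …, 0`.
    rw [← h1, ← h2, Matrix.det_succ_column_zero, Fin.sum_univ_succ, Fin.sum_univ_succ,
      sum_eq_zero, add_zero, sub_eq_add_neg]
    · congr 1
      · simp only [Matrix.of_apply, Fin.val_zero, pow_zero, one_mul, zero_add]
        rw [mul_comm, ← Nat.cast_sub h01.le]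
        congr 2
      · simp only [Matrix.of_apply, Fin.val_succ, Fin.val_zero, zero_add, pow_one, sub_self, g0,
          mul_one, neg_one_mul]
        congr 2
        ext1 i j
        simp only [Matrix.submatrix_apply, Matrix.of_apply, Fin.val_succ]
        congr 3
        refine Fin.cases ?_ (fun i => ?_) i
        · simp
        · rw [Fin.succ_succAbove_succ, Fin.zero_succAbove]
          simp
    · intro i _
      have : w ((i : ℕ) + 1 + 1) < w 1 := hlt i (by omega)
      simp only [Matrix.of_apply, Fin.val_succ, Fin.val_zero, zero_add]
      rw [gneg _ (by omega)]
      ring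

end Hessenberg

/-! ### Ribbons -/

section SkewDeterminant

variable {B : Type*} [CommRing B] {g : ℤ → B}

/-- An empty bottom row of the shape makes the last matrix row `(0, …, 0, 1)`. -/
theorem det_skew_truncate (g0 : g 0 = 1) (gneg : ∀ d < 0, g d = 0) {lam mu : ℕ → ℕ}
    (hmu : Antitone mu) {n N : ℕ} (hnN : n ≤ N) (h : ∀ i, n ≤ i → lam i = mu i) :
    (Matrix.of fun i j : Fin N => g ((lam i : ℤ) - (mu j : ℤ) - (i : ℤ) + (j : ℤ))).det =
      (Matrix.of fun i j : Fin n => g ((lam i : ℤ) - (mu j : ℤ) - (i : ℤ) + (j : ℤ))).det := by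
  induction N, hnN using Nat.le_induction with
  | base => rfl
  | succ k hk ih =>
    rw [← ih, Matrix.det_eq_of_last_row]
    · simp only [Matrix.of_apply, Fin.val_last, h k hk]
      rw [show (mu k : ℤ) - mu k - k + k = 0 by ring, g0, one_mul]
      rfl
    · intro j
      have := j.2
      have := hmu j.2.le
      simp only [Matrix.of_apply, Fin.val_last, h k hk, Fin.val_castSucc]
      exact gneg _ (by omega)

/-- An empty top row of the shape makes the first matrix column `(1, 0, …, 0)`. -/
theorem det_skew_shift (g0 : g 0 = 1) (gneg : ∀ d < 0, g d = 0) {lam mu : ℕ → ℕ}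
    (hlam : Antitone lam) {a : ℕ} (n : ℕ) (h : ∀ i < a, lam i = mu i) :
    (Matrix.of fun i j : Fin (n + a) => g ((lam i : ℤ) - (mu j : ℤ) - (i : ℤ) + (j : ℤ))).det =
      (Matrix.of fun i j : Fin n =>
        g ((lam (i + a) : ℤ) - (mu (j + a) : ℤ) - (i : ℤ) + (j : ℤ))).det := by
  induction a generalizing lam mu with
  | zero => rfl
  | succ a ih =>
    have := ih (lam := fun i => lam (i + 1)) (mu := fun i => mu (i + 1))
      (fun i j hij => hlam (by omega)) (fun i hi => h (i + 1) (by omega))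
    simp only [add_assoc] at this
    rw [← this]
    change (Matrix.of fun i j : Fin ((n + a) + 1) =>
      g ((lam i : ℤ) - (mu j : ℤ) - (i : ℤ) + (j : ℤ))).det = _
    rw [Matrix.det_eq_of_first_column]
    · simp only [Matrix.of_apply, Fin.val_zero, h 0 (Nat.succ_pos _)]
      rw [show (mu 0 : ℤ) - mu 0 - ((0 : ℕ) : ℤ) + ((0 : ℕ) : ℤ) = 0 by simp, g0, one_mul]
      congr 1
      ext1 i j
      simp only [Matrix.submatrix_apply, Matrix.of_apply, Fin.val_succ]
      congr 1
      push_cast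
      ring
    · intro i
      have := hlam (Nat.zero_le (i + 1 : ℕ))
      have := h 0 (Nat.succ_pos _)
      simp only [Matrix.of_apply, Fin.val_succ, Fin.val_zero]
      exact gneg _ (by push_cast; omega)

end SkewDeterminant

/-! ### Labels and adjacent rows of a ribbon -/

namespace SkewShape

variable {R : SkewShape}

theorem mem_cells {i j : ℕ} :
    (i, j) ∈ R.cells ↔ R.inner.rowLen i ≤ j ∧ j < R.outer.rowLen i := by
  rw [cells, mem_sdiff, YoungDiagram.mem_cells, YoungDiagram.mem_cells,
    YoungDiagram.mem_iff_lt_rowLen, YoungDiagram.mem_iff_lt_rowLen]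
  omega

theorem inner_rowLen_le (R : SkewShape) (i : ℕ) : R.inner.rowLen i ≤ R.outer.rowLen i := by
  by_contra! h
  exact lt_irrefl _ (YoungDiagram.mem_iff_lt_rowLen.1
    (R.inner_le (YoungDiagram.mem_iff_lt_rowLen.2 h)))

theorem mem_conj_cells {i j : ℕ} : (i, j) ∈ R.conj.cells ↔ (j, i) ∈ R.cells := by
  simp [cells, conj]

/-- The number of cells weakly below and weakly to the left of a cell. -/
def lowerLabel (R : SkewShape) (i j : ℕ) : ℕ := #{d ∈ R.cells | i ≤ d.1 ∧ d.2 ≤ j}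

/-- Conjugation reverses the direction of labeling: the labels of `R'` number the cells of `R` from
the bottom left. -/
theorem label_conj (i j : ℕ) : R.conj.label (j, i) = R.lowerLabel i j := by
  refine card_bij (fun c _ => c.swap) ?_ (fun c _ d _ h => Prod.swap_injective h) ?_
  · rintro ⟨c, d⟩ h
    rw [mem_filter, mem_conj_cells] at h
    exact mem_filter.2 ⟨h.1, h.2.2, h.2.1⟩
  · rintro ⟨c, d⟩ h
    rw [mem_filter] at h
    exact ⟨(d, c), mem_filter.2 ⟨mem_conj_cells.2 h.1, h.2.2, h.2.1⟩, rfl⟩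

theorem IsRibbon.not_square (hR : R.IsRibbon) {i j : ℕ} (h1 : (i, j) ∈ R.cells)
    (h2 : (i + 1, j + 1) ∈ R.cells) : False := by
  rw [mem_cells] at h1 h2
  have e1 := R.outer.rowLen_anti i (i + 1) (Nat.le_succ i)
  have e2 := R.inner.rowLen_anti i (i + 1) (Nat.le_succ i)
  refine hR.2 i j ⟨?_, ?_, ?_, ?_⟩ <;> rw [mem_cells] <;> omega

/-- A further cell of `R` below `(i, j + 1)` in its column would put `(i + 1, j + 1)` in `R` and so
complete a square. -/
theorem IsRibbon.lowerLabel_right (hR : R.IsRibbon) {i j : ℕ} (h1 : (i, j) ∈ R.cells)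
    (h2 : (i, j + 1) ∈ R.cells) : R.lowerLabel i (j + 1) = R.lowerLabel i j + 1 := by
  rw [lowerLabel, lowerLabel, ← card_insert_of_notMem (a := (i, j + 1)) (by simp)]
  congr 1
  ext ⟨r, c⟩
  simp only [mem_filter, mem_insert, Prod.mk.injEq]
  constructor
  · rintro ⟨h, hr, hc⟩
    rcases hc.lt_or_eq with hc | rfl
    · exact Or.inr ⟨h, hr, by omega⟩
    · rcases hr.lt_or_eq with hr | rfl
      · refine (hR.not_square h1 ?_).elim
        rw [mem_cells] at *
        have := R.outer.rowLen_anti (i + 1) r hr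
        have := R.inner.rowLen_anti i (i + 1) (Nat.le_succ i)
        omega
      · exact Or.inl ⟨rfl, rfl⟩
  · rintro (⟨rfl, rfl⟩ | ⟨h, hr, hc⟩)
    · exact ⟨h2, le_rfl, le_rfl⟩
    · exact ⟨h, hr, by omega⟩

theorem IsRibbon.lowerLabel_up (hR : R.IsRibbon) {i j : ℕ} (h1 : (i, j) ∈ R.cells)
    (h2 : (i + 1, j) ∈ R.cells) : R.lowerLabel i j = R.lowerLabel (i + 1) j + 1 := by
  rw [lowerLabel, lowerLabel, ← card_insert_of_notMem (a := (i, j)) (by simp)]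
  congr 1
  ext ⟨r, c⟩
  simp only [mem_filter, mem_insert, Prod.mk.injEq]
  constructor
  · rintro ⟨h, hr, hc⟩
    rcases hr.lt_or_eq with hr | rfl
    · exact Or.inr ⟨h, hr, hc⟩
    · rcases hc.lt_or_eq with hc | rfl
      · obtain ⟨k, rfl⟩ : ∃ k, j = k + 1 := ⟨j - 1, by omega⟩
        refine (hR.not_square (i := i) (j := k) ?_ h2).elim
        rw [mem_cells] at *
        omega
      · exact Or.inl ⟨rfl, rfl⟩
  · rintro (⟨rfl, rfl⟩ | ⟨h, hr, hc⟩)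
    · exact ⟨h1, le_rfl, le_rfl⟩
    · exact ⟨h, by omega, hc⟩

theorem hasse_adj_iff {x y : ℕ × ℕ} : (SimpleGraph.hasse (ℕ × ℕ)).Adj x y ↔
    (x.1 = y.1 ∧ (x.2 + 1 = y.2 ∨ y.2 + 1 = x.2)) ∨
      (x.2 = y.2 ∧ (x.1 + 1 = y.1 ∨ y.1 + 1 = x.1)) := by
  rw [SimpleGraph.hasse_adj, Prod.covBy_iff, Prod.covBy_iff]
  simp only [Nat.covBy_iff_add_one_eq]
  omega

theorem IsRibbon.exists_adj_crossing (hR : R.IsRibbon) {x y : ℕ × ℕ} (hx : x ∈ R.cells)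
    (hy : y ∈ R.cells) (S : Set (ℕ × ℕ)) (hxS : x ∈ S) (hyS : y ∉ S) :
    ∃ c ∈ R.cells, ∃ d ∈ R.cells, (SimpleGraph.hasse (ℕ × ℕ)).Adj c d ∧ c ∈ S ∧ d ∉ S := by
  obtain ⟨p⟩ := hR.1 ⟨x, hx⟩ ⟨y, hy⟩
  obtain ⟨e, -, h1, h2⟩ := p.exists_boundary_dart (Subtype.val ⁻¹' S) hxS hyS
  exact ⟨e.fst.1, e.fst.2, e.snd.1, e.snd.2, e.adj, h1, h2⟩

/-- In a ribbon, labels and contents differ by a constant. -/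
theorem IsRibbon.lowerLabel_sub_content (hR : R.IsRibbon) {x y : ℕ × ℕ} (hx : x ∈ R.cells)
    (hy : y ∈ R.cells) : (R.lowerLabel x.1 x.2 : ℤ) - x.2 + x.1 =
      (R.lowerLabel y.1 y.2 : ℤ) - y.2 + y.1 := by
  by_contra h
  obtain ⟨⟨i, j⟩, hc, ⟨i', j'⟩, hd, hadj, h1, h2⟩ := hR.exists_adj_crossing hx hy
    {c | (R.lowerLabel c.1 c.2 : ℤ) - c.2 + c.1 = (R.lowerLabel x.1 x.2 : ℤ) - x.2 + x.1} rfl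
    (fun h' => h h'.symm)
  rw [hasse_adj_iff] at hadj
  simp only [Set.mem_ofPred_eq] at h1 h2 hadj
  rcases hadj with ⟨rfl, rfl | rfl⟩ | ⟨rfl, rfl | rfl⟩
  · have := hR.lowerLabel_right hc hd
    omega
  · have := hR.lowerLabel_right hd hc
    omega
  · have := hR.lowerLabel_up hc hd
    omega
  · have := hR.lowerLabel_up hd hc
    omega

/-- Connectedness yields a vertical edge between rows `i` and `i + 1`, so the two rows share a
column; without squares they share only one. -/
theorem IsRibbon.outer_rowLen_succ (hR : R.IsRibbon) {x y : ℕ × ℕ} (hx : x ∈ R.cells)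
    (hy : y ∈ R.cells) {i : ℕ} (h1 : x.1 ≤ i) (h2 : i < y.1) :
    R.outer.rowLen (i + 1) = R.inner.rowLen i + 1 := by
  obtain ⟨⟨r, c⟩, hc, ⟨r', c'⟩, hd, hadj, h3, h4⟩ := hR.exists_adj_crossing hx hy
    {c | c.1 ≤ i} h1 (by simpa using h2)
  rw [hasse_adj_iff] at hadj
  simp only [Set.mem_ofPred_eq] at h3 h4 hadj
  obtain rfl : c = c' := by omega
  obtain rfl : r = i := by omega
  obtain rfl : r' = r + 1 := by omega
  have hsq := hR.not_square (i := r) (j := R.inner.rowLen r)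
  rw [mem_cells] at hc hd hsq
  rw [mem_cells] at hsq
  have := R.inner.rowLen_anti r (r + 1) (Nat.le_succ r)
  by_contra hne
  exact hsq ⟨le_rfl, by omega⟩ ⟨by omega, by omega⟩

end SkewShape

/-! ### From a ribbon to a Hessenberg determinant -/

namespace SkewShape

variable {R : SkewShape}

theorem IsRibbon.lowerLabel_mem_Icc (hR : R.IsRibbon) {r c : ℕ} (h1 : (r, c) ∈ R.cells)
    (h2 : (r, c + 1) ∈ R.cells) : R.lowerLabel r c ∈ Icc 1 (R.size - 1) := by
  have h3 := hR.lowerLabel_right h1 h2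
  have h4 : R.lowerLabel r (c + 1) ≤ R.size := card_le_card (filter_subset _ _)
  have h5 : 0 < R.lowerLabel r c := card_pos.2 ⟨(r, c), by simp [h1]⟩
  rw [mem_Icc]
  omega

/-- Descents of `R'` are the horizontal steps of `R`. -/
theorem IsRibbon.mem_conj_Des (hR : R.IsRibbon) {i : ℕ} : i ∈ R.conj.Des ↔
    ∃ r c : ℕ, (r, c) ∈ R.cells ∧ (r, c + 1) ∈ R.cells ∧ R.lowerLabel r c = i := by
  have hsize : R.conj.size = R.size := by
    refine card_bij (fun c _ => c.swap) ?_ (fun c _ d _ h => Prod.swap_injective h) ?_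
    · rintro ⟨c, d⟩ h
      exact mem_conj_cells.1 h
    · rintro ⟨c, d⟩ h
      exact ⟨(d, c), mem_conj_cells.2 h, rfl⟩
  classical
  rw [Des, mem_filter, hsize]
  simp only [mem_conj_cells, label_conj]
  constructor
  · rintro ⟨-, c, r, h1, h2, h3, -⟩
    exact ⟨r, c, h1, h2, h3⟩
  · rintro ⟨r, c, h1, h2, rfl⟩
    exact ⟨hR.lowerLabel_mem_Icc h1 h2, c, r, h1, h2, rfl, hR.lowerLabel_right h1 h2⟩

variable {B : Type*} [CommRing B]

theorem det_eq_one_of_size_eq_zero {g : ℤ → B} (g0 : g 0 = 1) (gneg : ∀ d < 0, g d = 0)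
    (h : R.size = 0) : (Matrix.of fun i j : Fin R.length =>
      g ((R.outer.rowLen i : ℤ) - (R.inner.rowLen j : ℤ) - (i : ℤ) + (j : ℤ))).det = 1 := by
  rw [det_skew_truncate g0 gneg (fun i j hij => R.inner.rowLen_anti i j hij) (Nat.zero_le _),
    Matrix.det_fin_zero]
  intro i _
  have h1 := R.inner_rowLen_le i
  by_contra hne
  have : (i, R.inner.rowLen i) ∈ R.cells := mem_cells.2 ⟨le_rfl, by omega⟩
  rw [card_eq_zero.1 h] at this
  exact notMem_empty _ this

/-- A Jacobi--Trudi type determinant of a ribbon `R` is an alternating sum over the subsets of the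
complement of `Des R'`. -/
theorem IsRibbon.det_eq_alternatingCutSum (hR : R.IsRibbon) {G : ℕ → Finset ℕ → B} {g : ℤ → B}
    (hG : ∀ n m D, n ≤ m → D ⊆ Icc 1 (n - 1) → G m (D ∪ Ioo n m) = G n D * g ((m - n : ℕ) : ℤ))
    (hG0 : G 0 ∅ = 1) (g0 : g 0 = 1) (gneg : ∀ d < 0, g d = 0) :
    (Matrix.of fun i j : Fin R.length =>
      g ((R.outer.rowLen i : ℤ) - (R.inner.rowLen j : ℤ) - (i : ℤ) + (j : ℤ))).det =
      alternatingCutSum G R.size (Icc 1 (R.size - 1) \ R.conj.Des) := by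
  rcases Nat.eq_zero_or_pos R.size with hm | hm
  · rw [det_eq_one_of_size_eq_zero g0 gneg hm, hm]
    simp [alternatingCutSum, hG0]
  obtain ⟨⟨a, ja⟩, ha, hmin⟩ := exists_min_image R.cells Prod.fst (card_pos.1 hm)
  obtain ⟨⟨b, jb⟩, hb, hmax⟩ := exists_max_image R.cells Prod.fst (card_pos.1 hm)
  have hab : a ≤ b := hmin _ hb
  set lam := R.outer.rowLen with hlam
  set mu := R.inner.rowLen with hmu
  have lam_anti : Antitone lam := fun i j hij => R.outer.rowLen_anti i j hij
  have mu_anti : Antitone mu := fun i j hij => R.inner.rowLen_anti i j hij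
  have hle : ∀ i, mu i ≤ lam i := R.inner_rowLen_le
  have hmem : ∀ i j, (i, j) ∈ R.cells ↔ mu i ≤ j ∧ j < lam i := fun i j => mem_cells
  have hstep : ∀ i, a ≤ i → i < b → lam (i + 1) = mu i + 1 := fun i h1 h2 =>
    hR.outer_rowLen_succ ha hb h1 h2
  have hafter : ∀ i, b + 1 ≤ i → lam i = mu i := by
    intro i hi
    by_contra hne
    have := hmax (i, mu i) ((hmem _ _).2 ⟨le_rfl, (hle i).lt_of_ne' hne⟩)
    simp only at this
    omega
  have hbefore : ∀ i < a, lam i = mu i := by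
    intro i hi
    by_contra hne
    have := hmin (i, mu i) ((hmem _ _).2 ⟨le_rfl, (hle i).lt_of_ne' hne⟩)
    simp only at this
    omega
  have hb' := (hmem _ _).1 hb
  have ha' := (hmem _ _).1 ha
  have hrow : ∀ i, a ≤ i → i ≤ b → mu i < lam i := by
    intro i h1 h2
    rcases h2.lt_or_eq with h2 | rfl
    · have := hstep i h1 h2
      have := lam_anti (Nat.le_succ i)
      simp only [Nat.succ_eq_add_one] at this
      omega
    · omega
  have hlast : (b, mu b) ∈ R.cells := (hmem _ _).2 ⟨le_rfl, by omega⟩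
  have hfirst : (a, lam a - 1) ∈ R.cells := (hmem _ _).2 ⟨by omega, by omega⟩
  have hlabel_last : R.lowerLabel b (mu b) = 1 := by
    rw [lowerLabel, card_eq_one]
    refine ⟨(b, mu b), ?_⟩
    ext ⟨r, c⟩
    simp only [mem_filter, mem_singleton, Prod.mk.injEq]
    constructor
    · rintro ⟨h1, h2, h3⟩
      have h4 : r ≤ b := hmax _ h1
      obtain rfl : r = b := le_antisymm h4 h2
      exact ⟨rfl, le_antisymm h3 ((hmem _ _).1 h1).1⟩
    · rintro ⟨rfl, rfl⟩
      exact ⟨hlast, le_rfl, le_rfl⟩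
  have hlabel_first : R.lowerLabel a (lam a - 1) = R.size := by
    rw [lowerLabel, size, filter_true_of_mem]
    rintro ⟨r, c⟩ h
    have h1 : a ≤ r := hmin _ h
    have h2 := lam_anti h1
    have := (hmem _ _).1 h
    exact ⟨h1, by simp only; omega⟩
  have hlabel : ∀ r c, (r, c) ∈ R.cells → R.lowerLabel r c + mu b + r = c + 1 + b := by
    intro r c h
    have h1 := hR.lowerLabel_sub_content h hlast
    simp only [hlabel_last] at h1
    omega
  have hsize : R.size + mu b + a = lam a + b := by
    have h1 := hlabel _ _ hfirst
    omega
  -- `w i` is the label, counted from the bottom left, of the rightmost cell of row `a + i`. The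
  -- formula computes it as the label of the leftmost cell of the row above, minus one, which also
  -- gives the final value `0` below row `b`.
  let w : ℕ → ℕ := fun i =>
    if i = 0 then R.size else (mu (i - 1 + a) + b) - (i - 1 + a + mu b)
  have hw_succ : ∀ j, j + a ≤ b → w (j + 1) + (j + a + mu b) = mu (j + a) + b := by
    intro j hj
    have := mu_anti hj
    simp only [w, Nat.add_eq_zero_iff, one_ne_zero, and_false, if_false, Nat.add_sub_cancel]
    omega
  have hw : ∀ i, i + a ≤ b → w i + (i + a + mu b) = lam (i + a) + b := by
    intro i hi
    rcases i with _ | i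
    · simp only [w, if_true, zero_add]
      omega
    · have h1 := hw_succ i (by omega)
      have h2 := hstep (i + a) (by omega) (by omega)
      rw [show i + 1 + a = i + a + 1 by ring]
      omega
  have hlength : b + 1 ≤ R.length :=
    YoungDiagram.mem_iff_lt_colLen.1 (YoungDiagram.mem_iff_lt_rowLen.2 (by
      change 0 < lam b
      omega))
  rw [det_skew_truncate g0 gneg mu_anti hlength hafter]
  obtain ⟨k, rfl⟩ : ∃ k, b = k + a := ⟨b - a, by omega⟩
  rw [show k + a + 1 = k + 1 + a by ring, det_skew_shift g0 gneg lam_anti _ hbefore]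
  have hmat : (Matrix.of fun i j : Fin (k + 1) =>
      g ((lam (i + a) : ℤ) - (mu (j + a) : ℤ) - (i : ℤ) + (j : ℤ))) =
      Matrix.of fun i j : Fin (k + 1) => g ((w i : ℤ) - (w (j + 1) : ℤ)) := by
    ext1 i j
    have h1 := hw i (by omega)
    have h2 := hw_succ j (by omega)
    simp only [Matrix.of_apply]
    congr 1
    omega
  rw [hmat, _root_.det_eq_alternatingCutSum hG hG0 g0 gneg k w]
  · change alternatingCutSum G R.size _ = _
    congr 1
    ext i
    rw [mem_sdiff, mem_image, hR.mem_conj_Des, mem_Icc]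
    constructor
    · rintro ⟨t, ht, rfl⟩
      rw [mem_range] at ht
      have h1 := hw_succ t (by omega)
      have h2 := hw (t + 1) (by omega)
      have h3 := mu_anti (show t + a ≤ k + a by omega)
      have h4 := lam_anti (show a ≤ t + 1 + a by omega)
      refine ⟨⟨by omega, by omega⟩, ?_⟩
      -- The label `w (t + 1)` sits at the right end of row `t + 1 + a`, so no horizontal step
      -- starts there.
      rintro ⟨r, c, hc1, hc2, hc3⟩
      have h5 := hlabel _ _ hc1
      rw [hmem] at hc1 hc2
      rcases le_or_gt r (t + a) with h | h
      · have := mu_anti h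
        omega
      · have := lam_anti (show t + 1 + a ≤ r by omega)
        omega
    · rintro ⟨⟨hi1, hi2⟩, hi⟩
      by_contra hne
      have hne' : ∀ t, t < k → w (t + 1) ≠ i := fun t ht h => hne ⟨t, mem_range.2 ht, h⟩
      -- Row `a + s` carries the labels in `(w (s + 1), w s]`. The greatest `s` with `i < w s`
      -- locates the row of `i`, and strictness supplies a right neighbour.
      let P : ℕ → Prop := fun s => i < w s
      have hP0 : P 0 := by
        simp only [P, w, if_true]
        omega
      classical
      set s := Nat.findGreatest P k with hs
      have hsP : P s := Nat.findGreatest_spec (Nat.zero_le k) hP0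
      have hsk : s ≤ k := Nat.findGreatest_le k
      have hs' : w (s + 1) < i := by
        rcases hsk.lt_or_eq with h | h
        · have h1 : ¬ P (s + 1) := Nat.findGreatest_is_greatest (Nat.lt_succ_self s) h
          have h2 := hne' s h
          simp only [P] at h1
          omega
        · have h1 := hw_succ s (by omega)
          rw [h] at h1 ⊢
          omega
      simp only [P] at hsP
      have h1 := hw_succ s (by omega)
      have h2 := hw s (by omega)
      -- The column is obtained by solving `hlabel` for the label `i`.
      have hc : (s + a, i + s + a + mu (k + a) - (k + a) - 1) ∈ R.cells := by
        rw [hmem]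
        omega
      refine hi ⟨_, _, hc, ?_, ?_⟩
      · rw [hmem]
        omega
      · have := hlabel _ _ hc
        omega
  · intro i hi
    have h1 := hw i (by omega)
    have h2 := hw_succ i (by omega)
    have h3 := hrow (i + a) (by omega) (by omega)
    omega
  · have := hw_succ k le_rfl
    omega

end SkewShape

/-! ### The expansion of the Hadamard product -/

/-- Expand the product over `i ∈ C` of `1 - 1` for `i ∉ U` and `1 + 0` for `i ∈ U`, with `T`
recording where the first summand is chosen. -/
theorem sum_powerset_superset_sign {B : Type*} [CommRing B] (C U : Finset ℕ) (hU : U ⊆ C) :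
    ∑ T ∈ C.powerset, (if U ⊆ T then (-1 : B) ^ (#C + #T) else 0) = if U = C then 1 else 0 := by
  have h := prod_add (fun _ : ℕ => (1 : B)) (fun i => if i ∉ U then -1 else 0) C
  have hl : ∏ i ∈ C, ((1 : B) + if i ∉ U then -1 else 0) = if U = C then 1 else 0 := by
    have h1 : ∀ i ∈ C, ((1 : B) + if i ∉ U then -1 else 0) = if i ∈ U then 1 else 0 := by
      intro i _
      by_cases hi : i ∈ U <;> simp [hi]
    rw [prod_congr rfl h1, prod_ite_zero, prod_const_one]
    exact if_congr ⟨fun h => Subset.antisymm hU h, fun h => h ▸ fun i hi => hi⟩ rfl rfl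
  rw [← hl, h]
  refine sum_congr rfl fun T hT => ?_
  rw [mem_powerset] at hT
  rw [prod_const_one, one_mul, prod_ite_zero, prod_const]
  refine if_congr ⟨fun h i hi hiU => (mem_sdiff.1 hi).2 (h hiU), fun h i hi => ?_⟩ ?_ rfl
  · by_contra hiT
    exact h i (mem_sdiff.2 ⟨hU hi, hiT⟩) hi
  · have := card_sdiff_add_card_eq_card hT
    rw [← this, add_assoc, pow_add, ← two_mul, pow_mul]
    simp

theorem Finset.sum_piFinset_fin_two {α M : Type*} [AddCommMonoid M] [DecidableEq α] (s : Finset α)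
    (f : (Fin 2 → α) → M) :
    ∑ v ∈ Fintype.piFinset fun _ : Fin 2 => s, f v = ∑ a ∈ s, ∑ b ∈ s, f ![a, b] := by
  rw [← sum_product' s s fun a b => f ![a, b]]
  refine sum_equiv (finTwoArrowEquiv α) (fun v => ?_) fun v _ => ?_
  · simp [Fintype.mem_piFinset, Fin.forall_fin_two]
  · congr 1
    ext i
    fin_cases i <;> rfl

section Expansion

variable {k : ℕ}

open Classical in
theorem prod_schurDescentSum (m : ℕ) (D : Finset ℕ) :
    ∏ p : Fin k, inVars p (schurDescentSum m D) =
      ∑ ν ∈ Fintype.piFinset fun _ : Fin k => partitionsOf m,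
        ∑ A ∈ Fintype.piFinset fun _ : Fin k => (Icc 1 (m - 1)).powerset,
          (if ∀ p, D ⊆ A p then ∏ p, numSYT (ν p) (A p) else 0) •
            ∏ p, inVars p (schur (ν p)) := by
  have h1 : ∀ p : Fin k, inVars p (schurDescentSum m D) = ∑ ν ∈ partitionsOf m,
      (∑ A ∈ (Icc 1 (m - 1)).powerset, if D ⊆ A then numSYT ν A else 0) •
        inVars p (schur ν) := by
    intro p
    rw [schurDescentSum, map_sum]
    refine sum_congr rfl fun ν hν => ?_
    rw [mem_partitionsOf] at hν
    rw [map_nsmul, numSYTContaining_eq_sum_numSYT, hν, sum_filter]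
  rw [prod_congr rfl fun p _ => h1 p, prod_univ_sum]
  refine sum_congr rfl fun ν _ => ?_
  rw [prod_smul, prod_univ_sum, sum_smul]
  refine sum_congr rfl fun A _ => ?_
  rw [prod_ite_zero]
  simp

open Classical in
theorem alternatingCutSum_prod_schurDescentSum (hk : 1 ≤ k) (m : ℕ) {D : Finset ℕ}
    (hD : D ⊆ Icc 1 (m - 1)) :
    alternatingCutSum (fun m D => ∏ p : Fin k, inVars p (schurDescentSum m D)) m
        (Icc 1 (m - 1) \ D) =
      ∑ ν ∈ Fintype.piFinset fun _ : Fin k => partitionsOf m,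
        (∑ A ∈ Fintype.piFinset fun _ : Fin k => (Icc 1 (m - 1)).powerset with
            ⋂ p, (A p : Set ℕ) = (D : Set ℕ),
          ∏ p, numSYT (ν p) (A p)) • ∏ p, inVars p (schur (ν p)) := by
  rw [alternatingCutSum]
  simp_rw [prod_schurDescentSum, mul_sum]
  rw [sum_comm]
  refine sum_congr rfl fun ν _ => ?_
  rw [sum_comm, sum_filter, sum_smul]
  refine sum_congr rfl fun A hA => ?_
  have hA' : ∀ p, A p ⊆ Icc 1 (m - 1) := fun p => mem_powerset.1 (Fintype.mem_piFinset.1 hA p)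
  -- `U` is the complement in `[m-1]` of the intersection of the `A p`; the tuple contributes to the
  -- term of `T` exactly when `U ⊆ T`.
  let U : Finset ℕ := {i ∈ Icc 1 (m - 1) | ∃ p, i ∉ A p}
  have hU : ∀ T, (∀ p, Ioo 0 m \ T ⊆ A p) ↔ U ⊆ T := by
    intro T
    constructor
    · intro h i hi
      obtain ⟨hi, p, hp⟩ := mem_filter.1 hi
      by_contra hiT
      rw [mem_Icc] at hi
      exact hp (h p (mem_sdiff.2 ⟨mem_Ioo.2 (by omega), hiT⟩))
    · intro h p i hi
      rw [mem_sdiff, mem_Ioo] at hi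
      by_contra hp
      exact hi.2 (h (mem_filter.2 ⟨mem_Icc.2 (by omega), p, hp⟩))
  have hUC : U = Icc 1 (m - 1) \ D ↔ ⋂ p, (A p : Set ℕ) = (D : Set ℕ) := by
    rw [Finset.ext_iff, Set.ext_iff]
    refine forall_congr' fun i => ?_
    simp only [U, mem_filter, mem_sdiff, Set.mem_iInter, mem_coe]
    by_cases hi : i ∈ Icc 1 (m - 1)
    · simp only [hi, true_and]
      rw [← not_forall, not_iff_not]
    -- Here `1 ≤ k` matters: an empty intersection would be all of `ℕ`.
    · have h1 : ¬ ∀ p, i ∈ A p := fun h => hi (hA' ⟨0, hk⟩ (h _))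
      have h2 : i ∉ D := fun h => hi (hD h)
      simp [hi, h1, h2]
  have hterm : ∀ T ∈ (Icc 1 (m - 1) \ D).powerset,
      (-1 : MvPowerSeries (Fin k × ℕ) ℚ) ^ (#(Icc 1 (m - 1) \ D) + #T) *
        ((if ∀ p, Ioo 0 m \ T ⊆ A p then ∏ p, numSYT (ν p) (A p) else 0) •
          ∏ p, inVars p (schur (ν p))) =
      (if U ⊆ T then (-1) ^ (#(Icc 1 (m - 1) \ D) + #T) else 0) *
        ((∏ p, numSYT (ν p) (A p)) • ∏ p, inVars p (schur (ν p))) := by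
    intro T _
    by_cases h : U ⊆ T
    · rw [if_pos h, if_pos ((hU T).2 h)]
    · rw [if_neg h, if_neg (mt (hU T).1 h), zero_smul, mul_zero, zero_mul]
  rw [sum_congr rfl hterm, ← sum_mul]
  by_cases hsub : U ⊆ Icc 1 (m - 1) \ D
  · rw [sum_powerset_superset_sign _ _ hsub]
    by_cases h : U = Icc 1 (m - 1) \ D
    · rw [if_pos h, if_pos (hUC.1 h), one_mul]
    · rw [if_neg h, if_neg (mt hUC.2 h), zero_mul, zero_smul]
  · rw [if_neg fun h => hsub (hUC.2 h).subset, zero_smul, sum_eq_zero, zero_mul]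
    intro T hT
    exact if_neg fun h => hsub (h.trans (mem_powerset.1 hT))

open Classical in
theorem SkewShape.IsRibbon.det_hadamardProd {R : SkewShape} (hR : R.IsRibbon) (hk : 1 ≤ k) :
    (hadamardProd fun p : Fin k => R.jacobiTrudiIn p).det =
      ∑ ν ∈ Fintype.piFinset fun _ : Fin k => partitionsOf R.size,
        (∑ A ∈ Fintype.piFinset fun _ : Fin k => (Icc 1 (R.size - 1)).powerset with
            ⋂ p, (A p : Set ℕ) = (R.conj.Des : Set ℕ),
          ∏ p, numSYT (ν p) (A p)) • ∏ p, inVars p (schur (ν p)) := by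
  have hDes : R.conj.Des ⊆ Icc 1 (R.size - 1) := by
    intro i hi
    obtain ⟨r, c, h1, h2, rfl⟩ := hR.mem_conj_Des.1 hi
    exact hR.lowerLabel_mem_Icc h1 h2
  rw [← alternatingCutSum_prod_schurDescentSum hk _ hDes]
  -- Ring homomorphisms and products over `p` preserve the cutting rule, so the single-variable
  -- identity passes to all `k` sequences at once.
  refine Eq.trans ?_ (hR.det_eq_alternatingCutSum
    (G := fun m D => ∏ p : Fin k, inVars p (schurDescentSum m D))
    (g := fun d => ∏ p : Fin k, inVars p (elemSymm d)) ?_ ?_ ?_ ?_)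
  · rfl
  · intro n m D hnm hD
    simp only [schurDescentSum_union_Ioo hnm hD, map_mul, prod_mul_distrib]
  · simp [schurDescentSum_zero]
  · simp [elemSymm_zero]
  · intro d hd
    -- Vanishing in negative degree needs a nonempty product, hence `1 ≤ k`.
    exact prod_eq_zero (mem_univ ⟨0, hk⟩) (by rw [elemSymm_of_neg hd, map_zero])

end Expansion

end

open Classical in
/-- The first part is the expansion for two sequences of variables `x = x^{(0)}`, `y = x^{(1)}`,
the second part the one for `k ≥ 1` sequences. -/
theorem theorem1p2 (m : ℕ) (R : SkewShape) (hR : R.IsRibbon) (hm : R.size = m) :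
    (Matrix.hadamard (R.jacobiTrudiIn (0 : Fin 2)) (R.jacobiTrudiIn (1 : Fin 2))).det =
        ∑ lam ∈ partitionsOf m, ∑ mu ∈ partitionsOf m,
          ∑ IJ ∈ (Finset.Icc 1 (m - 1)).powerset ×ˢ (Finset.Icc 1 (m - 1)).powerset with
              IJ.1 ∩ IJ.2 = R.conj.Des,
            (numSYT lam IJ.1 * numSYT mu IJ.2) •
              (inVars (0 : Fin 2) (schur lam) * inVars (1 : Fin 2) (schur mu)) ∧
    ∀ k : ℕ, 1 ≤ k →
      (hadamardProd fun p : Fin k => R.jacobiTrudiIn p).det =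
        ∑ ν ∈ Fintype.piFinset fun _ : Fin k => partitionsOf m,
          (∑ A ∈ Fintype.piFinset fun _ : Fin k => (Finset.Icc 1 (m - 1)).powerset with
              ⋂ p, (A p : Set ℕ) = (R.conj.Des : Set ℕ),
            ∏ p, numSYT (ν p) (A p)) •
          ∏ p, inVars p (schur (ν p)) := by
  subst hm
  refine ⟨?_, fun k hk => hR.det_hadamardProd hk⟩
  have h := hR.det_hadamardProd (k := 2) one_le_two
  have hM : Matrix.hadamard (R.jacobiTrudiIn (0 : Fin 2)) (R.jacobiTrudiIn (1 : Fin 2)) =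
      hadamardProd fun p : Fin 2 => R.jacobiTrudiIn p := by
    ext1 i j
    simp [hadamardProd, Fin.prod_univ_two]
  rw [hM, h, sum_piFinset_fin_two]
  refine sum_congr rfl fun lam _ => sum_congr rfl fun mu _ => ?_
  rw [← sum_smul, sum_filter, sum_filter, sum_piFinset_fin_two, sum_product]
  congr 1
  · refine sum_congr rfl fun I _ => sum_congr rfl fun J _ => ?_
    refine if_congr ?_ (by simp [Fin.prod_univ_two]) rfl
    rw [← coe_inj, coe_inter, Set.ext_iff, Set.ext_iff]
    simp [Fin.forall_fin_two]
  · simp [Fin.prod_univ_two]
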